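/- **Computational Stein's lemma.** *Functions up to negligible differences.* For $f,g:\mathbb N\to\mathbb R$ let $d(f,g)=\limsup_{n\to\infty}\exp\big(\log|f(n)-g(n)|/\log n\big)\in[0,\infty]$, the term being $0$ where $f(n)=g(n)$. Then $f$ is negligible if $d(f,0)=0$ and polynomially bounded ($f\le O(\mathrm{poly}(n))$) if $d(f,0)<\infty$; $f\simeq g$ means $d(f,g)=0$, and $f\lesssim g$ means $f\le g+h$ for all large $n$ with $h$ negligible. For a sequence $u_k$ of (extended-real-valued) functions of $n$, $\liminf_{k\to\infty}u_k$ is the least upper bound, for the order $\lesssim$, of the set of functions $a:\mathbb N\to\mathbb R$ with $a\lesssim u_k$ for all large $k$. Explicitly, "$\liminf_k u_k\lesssim g$" means that $g$ is an upper bound of this set, and "$g\lesssim\liminf_k u_k$" means that $g$ lies below all of its upper bounds. Outer limits are limits in the pseudometric $d$: $f\lesssim\lim_\ell\liminf_k u_{\ell,k}$ means that for every $\delta>0$ and all large $\ell$ there is $g$ with $d(g,f)<\delta$ and $g\lesssim\liminf_k u_{\ell,k}$; $\lim_\ell\liminf_k u_{\ell,k}\lesssim f$ is defined in the same way with $\liminf_k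 u_{\ell,k}\lesssim g$; and $f\simeq\lim_\ell\liminf_k u_{\ell,k}$ means that both hold. All real quantities, including the error $\varepsilon$, are functions of $n$: in $\lim_{\varepsilon\to0}$, $\varepsilon$ runs over the functions $\mathbb N\to(0,1)$ with $1/\varepsilon$ polynomially bounded, and $\varepsilon\to0$ means $d(\varepsilon,0)\to0$. Thus $f\simeq\lim_{\varepsilon\to0}\lim_{\ell\to\infty}\liminf_{k\to\infty}u_{\varepsilon,\ell,k}$ means: for every $\delta>0$ there is $\eta>0$ such that for all such $\varepsilon$ with $d(\varepsilon,0)<\eta$ and all large $\ell$ there are $g_1,g_2$ with $d(g_i,f)<\delta$ and $g_1\lesssim\liminf_k u_{\varepsilon,\ell,k}\lesssim g_2$. *Complexity-limited measurements.* The gate complexity $C(U)$ of an operator $U$ on a qubit register is the least number of arbitrary two-qubit unitaries with product $U$. For a qubit register $\mathcal H$, $\mathcal Q(\mathcal H;G)$ is the set of effects $\langle0|_{\rm anc}U[\bigotimes_iA_i]U^\dagger|0\rangle_{\rm anc}$ with any number of ancilla qubits, $C(U)\le G$ and $A_i\in\{|0\rangle\langle0|,\mathbb I\}$; $\mathcal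 M(\mathcal H;G;K)$ is the set of measurements $(\Lambda_r)_{r=1}^K$, $\Lambda_r=\langle0|_{\rm anc}U[\bigotimes_iA_i^{(r)}]U^\dagger|0\rangle_{\rm anc}$, with $C(U)\le G$, $A_i^{(r)}\in\{|0\rangle\langle0|,|1\rangle\langle1|,\mathbb I\}$ and $\sum_r\bigotimes_iA_i^{(r)}=\mathbb I$; for $M\in\mathcal M(\mathcal H;G;K)$, $M[\rho]=(\mathrm{Tr}[\Lambda_r\rho])_r$. Put $$D_h^\varepsilon(\rho\|\sigma;G)=-\log\min\{\mathrm{Tr}[\Lambda\sigma]\,:\,\Lambda\in\mathcal Q(\mathcal H;G),\ \mathrm{Tr}[\Lambda\rho]\ge1-\varepsilon\},\qquad \mathbf D^{\mathbb C}(\rho\|\sigma;G;K)=\sup_{M\in\mathcal M(\mathcal H;G;K)}\mathbf D(M[\rho]\|M[\sigma])$$ for a classical divergence $\mathbf D$; below $\mathbf D$ is the relative entropy $D(p\|q)=\sum_rp_r\log(p_r/q_r)$ or the max-relative entropy $D_{\max}(p\|q)=\log\max_rp_r/q_r$. *Regularized quantities.* For families of states $\rho_n,\sigma_n$ the computational relative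 entropy, i.e. the optimal type II error exponent, is $$\underline D(\rho_n\|\sigma_n):\simeq\lim_{\varepsilon\to0}\lim_{\ell\to\infty}\liminf_{k\to\infty}\frac1{n^k}D_h^\varepsilon(\rho_n^{\otimes n^k}\|\sigma_n^{\otimes n^k};n^{k\ell}),$$ and the computational two-outcome measured divergence associated to $\mathbf D$ is $$\underline{\mathbf D}^{\mathbb 2}(\rho_n\|\sigma_n):\simeq\lim_{\ell\to\infty}\liminf_{k\to\infty}\frac1{n^k}\mathbf D^{\mathbb C}(\rho_n^{\otimes n^k}\|\sigma_n^{\otimes n^k};n^{k\ell};2).$$ **Theorem.** Let $\rho_n,\sigma_n$ be states on $N_n$ qubits, with $N_n$ polynomially bounded, such that $\underline D_{\max}^{\mathbb 2}(\rho_n\|\sigma_n)\lesssim p$ for some polynomially bounded function $p$. Then $$\underline D(\rho_n\|\sigma_n)\simeq\underline D^{\mathbb 2}(\rho_n\|\sigma_n),$$ in the following sense: a function $f:\mathbb N\to\mathbb R$ is a value of the limit that defines $\underline D(\rho_n\|\sigma_n)$ if and only if it is a value of the limit that defines $\underline D^{\mathbb 2}(\rho_n\|\sigma_n)$ (in particular,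 one limit exists if and only if the other does), and any two such values are equivalent under $\simeq$. Moreover, if $\underline D^{\mathbb 2}(\rho_n\|\sigma_n)$ exists, then for every constant $0<\varepsilon<1$ $$\underline D^{\mathbb 2}(\rho_n\|\sigma_n)\ \lesssim\ \lim_{\ell\to\infty}\liminf_{k\to\infty}\frac1{n^k}D_h^\varepsilon(\rho_n^{\otimes n^k}\|\sigma_n^{\otimes n^k};n^{k\ell})\ \lesssim\ \frac1{1-\varepsilon}\,\underline D^{\mathbb 2}(\rho_n\|\sigma_n).$$ -/

import Mathlib

open Filter Topology
open scoped ENNReal ComplexOrder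

namespace CompStein

noncomputable section

/-! ### Functions of the scaling variable, up to negligible functions -/

/-- The pseudometric of the asymptotic exponent,
`d(f, g) = limsup_n exp (log |f n - g n| / log n)` (the term is `0` where `f n = g n`). -/
def asympDist (f g : ℕ → ℝ) : ℝ≥0∞ :=
  limsup (fun n : ℕ => if f n = g n then (0 : ℝ≥0∞)
    else ENNReal.ofReal (Real.exp (Real.log |f n - g n| / Real.log n))) atTop

/-- `f` vanishes faster than every inverse polynomial: `d(f, 0) = 0`. -/
def Negligible (f : ℕ → ℝ) : Prop := asympDist f 0 = 0

/-- `f = O(poly(n))`: `d(f, 0) < ∞`. -/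
def PolyBounded (f : ℕ → ℝ) : Prop := asympDist f 0 < ⊤

/-- `f ≃ g`. -/
def NeglEq (f g : ℕ → ℝ) : Prop := asympDist f g = 0

/-- `f ≲ g`: `f ≤ g + h` with `h` negligible. The functions may take infinite values, so the
inequality is asked for all large `n`; for real-valued functions this is the same as for all `n`,
since a negligible function may be changed at finitely many places. -/
def NeglLE (f g : ℕ → EReal) : Prop :=
  ∃ h : ℕ → ℝ, Negligible h ∧ ∀ᶠ n in atTop, f n ≤ g n + (h n : EReal)

/-- Real-valued functions as extended-real-valued ones. -/
def ext (f : ℕ → ℝ) : ℕ → EReal := fun n => (f n : EReal)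

/-! ### Limits modulo negligible functions

In a partially ordered set the limit inferior of `u` is the least upper bound of
`{a | a ≤ u k for all large k}`. Here the order is `≲`. The least upper bound need not be attained
by a function, so the two inequalities that compare it with a function are defined separately; `g`
is the limit inferior exactly if both hold. -/

/-- `liminf_k u k ≲ g`: `g` is an upper bound of `{a | a ≲ u k for all large k}`. -/
def LiminfLE (u : ℕ → ℕ → EReal) (g : ℕ → ℝ) : Prop :=
  ∀ a : ℕ → ℝ, (∀ᶠ k in atTop, NeglLE (ext a) (u k)) → NeglLE (ext a) (ext g)

/-- `g ≲ liminf_k u k`: `g` is below every upper bound of `{a | a ≲ u k for all large k}`. -/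
def LELiminf (g : ℕ → ℝ) (u : ℕ → ℕ → EReal) : Prop :=
  ∀ b : ℕ → ℝ, LiminfLE u b → NeglLE (ext g) (ext b)

/-- `liminf_k u k ≲ g` for some `g` at distance less than `δ` from `f`. -/
def LiminfLEWithin (δ : ℝ≥0∞) (u : ℕ → ℕ → EReal) (f : ℕ → ℝ) : Prop :=
  ∃ g : ℕ → ℝ, asympDist g f < δ ∧ LiminfLE u g

/-- `g ≲ liminf_k u k` for some `g` at distance less than `δ` from `f`. -/
def LELiminfWithin (δ : ℝ≥0∞) (f : ℕ → ℝ) (u : ℕ → ℕ → EReal) : Prop :=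
  ∃ g : ℕ → ℝ, asympDist g f < δ ∧ LELiminf g u

/-- `lim_ℓ liminf_k u ℓ k ≲ f`, the outer limit being taken in the pseudometric. -/
def LimLiminfLE (u : ℕ → ℕ → ℕ → EReal) (f : ℕ → ℝ) : Prop :=
  ∀ δ : ℝ≥0∞, 0 < δ → ∀ᶠ l in atTop, LiminfLEWithin δ (u l) f

/-- `f ≲ lim_ℓ liminf_k u ℓ k`, the outer limit being taken in the pseudometric. -/
def LELimLiminf (f : ℕ → ℝ) (u : ℕ → ℕ → ℕ → EReal) : Prop :=
  ∀ δ : ℝ≥0∞, 0 < δ → ∀ᶠ l in atTop, LELiminfWithin δ f (u l)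

/-- `f ≃ lim_ℓ liminf_k u ℓ k`. If the inner limits inferior are functions `g ℓ`, this holds as
soon as `d(g ℓ, f) → 0`. -/
def IsLimLiminf (u : ℕ → ℕ → ℕ → EReal) (f : ℕ → ℝ) : Prop :=
  LELimLiminf f u ∧ LimLiminfLE u f

/-- Admissible type I errors: positive, less than one, and not smaller than inverse polynomial. -/
def IsErrorFunction (ε : ℕ → ℝ) : Prop :=
  (∀ n, 0 < ε n ∧ ε n < 1) ∧ PolyBounded (fun n => (ε n)⁻¹)

/-- `f ≃ lim_{ε → 0} lim_ℓ liminf_k u ε ℓ k`, where `ε` is, like every real quantity, a function of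
`n`, and `ε → 0` is convergence in the pseudometric `d`. -/
def IsLimLimLiminf (u : (ℕ → ℝ) → ℕ → ℕ → ℕ → EReal) (f : ℕ → ℝ) : Prop :=
  ∀ δ : ℝ≥0∞, 0 < δ → ∃ η : ℝ≥0∞, 0 < η ∧ ∀ ε : ℕ → ℝ, IsErrorFunction ε → asympDist ε 0 < η →
    ∀ᶠ l in atTop, LELiminfWithin δ f (u ε l) ∧ LiminfLEWithin δ (u ε l) f

/-! ### Qubits, gates and complexity-limited measurements -/

/-- Operators on the qubits labelled by `ι`, as matrices in the computational basis. -/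
abbrev Op (ι : Type) : Type := Matrix (ι → Fin 2) (ι → Fin 2) ℂ

section Register

variable {ι : Type} [Fintype ι] [DecidableEq ι]

/-- Density operators. -/
def IsState (ρ : Op ι) : Prop := ρ.PosSemidef ∧ ρ.trace = 1

/-- `ρ^{⊗ m}`; qubit `i` of copy `j` has the label `(j, i)`. -/
def tensorPow (ρ : Op ι) (m : ℕ) : Op (Fin m × ι) :=
  Matrix.of fun x y => ∏ j, ρ (fun i => x (j, i)) (fun i => y (j, i))

/-- `⨂ i, A i`. -/
def tensorOp (A : ι → Matrix (Fin 2) (Fin 2) ℂ) : Op ι :=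
  Matrix.of fun x y => ∏ i, A i (x i) (y i)

/-- An arbitrary unitary on two of the qubits, tensored with the identity on the others. -/
def IsTwoLocal (g : Op ι) : Prop :=
  ∃ i j : ι, i ≠ j ∧ ∃ V ∈ Matrix.unitaryGroup (Fin 2 × Fin 2) ℂ, ∀ x y : ι → Fin 2,
    g x y = if ∀ q, q ≠ i → q ≠ j → x q = y q then V (x i, x j) (y i, y j) else 0

/-- The gate complexity `C(U)`: the least number of two-local unitaries with product `U`. -/
def gateComplexity (U : Op ι) : ℕ∞ :=
  ⨅ (L : List (Op ι)) (_ : (∀ g ∈ L, IsTwoLocal g) ∧ L.prod = U), (L.length : ℕ∞)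

/-- `⟨0|_anc X |0⟩_anc`, for `a` ancilla qubits. -/
def ancZero {a : ℕ} (X : Op (ι ⊕ Fin a)) : Op ι :=
  Matrix.of fun x y => X (Sum.elim x fun _ => 0) (Sum.elim y fun _ => 0)

/-- `|b⟩⟨b|`. -/
def ketbra (b : Fin 2) : Matrix (Fin 2) (Fin 2) ℂ := Matrix.single b b 1

variable (ι) in
/-- The `G`-complexity POVM effects `𝒬(ℋ; G)`. -/
def effects (G : ℕ) : Set (Op ι) :=
  {Λ | ∃ (a : ℕ) (U : Op (ι ⊕ Fin a)) (A : ι ⊕ Fin a → Matrix (Fin 2) (Fin 2) ℂ),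
    gateComplexity U ≤ G ∧ (∀ i, A i = ketbra 0 ∨ A i = 1) ∧
    Λ = ancZero (U * tensorOp A * U.conjTranspose)}

variable (ι) in
/-- The `G`-complexity `K`-outcome measurements `ℳ(ℋ; G; K)`. -/
def measurements (G K : ℕ) : Set (Fin K → Op ι) :=
  {Λ | ∃ (a : ℕ) (U : Op (ι ⊕ Fin a)) (A : Fin K → ι ⊕ Fin a → Matrix (Fin 2) (Fin 2) ℂ),
    gateComplexity U ≤ G ∧ (∀ r i, A r i = ketbra 0 ∨ A r i = ketbra 1 ∨ A r i = 1) ∧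
    ∑ r, tensorOp (A r) = 1 ∧
    ∀ r, Λ r = ancZero (U * tensorOp (A r) * U.conjTranspose)}

/-- `Tr[Λ ρ]`. -/
def prob (Λ ρ : Op ι) : ℝ := (Λ * ρ).trace.re

/-- The type II error `β_h^ε(ρ ‖ σ; G) = min {Tr[Λ σ] | Λ ∈ 𝒬(ℋ; G), Tr[Λ ρ] ≥ 1 - ε}`. -/
def typeIIError (ε : ℝ) (ρ σ : Op ι) (G : ℕ) : ℝ≥0∞ :=
  ⨅ Λ ∈ {Λ | Λ ∈ effects ι G ∧ 1 - ε ≤ prob Λ ρ}, ENNReal.ofReal (prob Λ σ)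

/-- The `G`-complexity hypothesis testing relative entropy `D_h^ε(ρ ‖ σ; G) = -log β`. -/
def hypothesisTestingRelEntropy (ε : ℝ) (ρ σ : Op ι) (G : ℕ) : EReal :=
  -ENNReal.log (typeIIError ε ρ σ G)

/-- The classical relative entropy, `+∞` if `p` is not dominated by `q`. -/
def relEntropy {K : ℕ} (p q : Fin K → ℝ) : EReal :=
  open Classical in
  if ∃ r, q r = 0 ∧ p r ≠ 0 then ⊤ else ((∑ r, p r * Real.log (p r / q r) : ℝ) : EReal)

/-- The classical max-relative entropy `log ‖p / q‖_∞` (with `0 / 0 = 0` and `x / 0 = ∞`). -/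
def maxRelEntropy {K : ℕ} (p q : Fin K → ℝ) : EReal :=
  ENNReal.log (⨆ r, ENNReal.ofReal (p r) / ENNReal.ofReal (q r))

/-- The `G`-`K`-complexity measured divergence associated to the classical divergence `D`. -/
def measuredDivergence {K : ℕ} (D : (Fin K → ℝ) → (Fin K → ℝ) → EReal) (ρ σ : Op ι) (G : ℕ) :
    EReal :=
  ⨆ M ∈ measurements ι G K, D (fun r => prob (M r) ρ) (fun r => prob (M r) σ)

end Register

/-! ### The regularized quantities

`ρ` and `σ` are families of states, the `n`-th one on `N n` qubits. -/

variable {N : ℕ → ℕ}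

/-- `n^{-k} D_h^{ε(n)}(ρ_n^{⊗ n^k} ‖ σ_n^{⊗ n^k}; n^{kℓ})`, as a function of `ε, ℓ, k, n`. -/
def testingRate (ρ σ : ∀ n, Op (Fin (N n))) (ε : ℕ → ℝ) (l k n : ℕ) : EReal :=
  ((((n : ℝ) ^ k)⁻¹ : ℝ) : EReal) * hypothesisTestingRelEntropy (ε n)
    (tensorPow (ρ n) (n ^ k)) (tensorPow (σ n) (n ^ k)) (n ^ (k * l))

/-- `n^{-k} D^ℂ(ρ_n^{⊗ n^k} ‖ σ_n^{⊗ n^k}; n^{kℓ}; 2)`, as a function of `ℓ, k, n`. -/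
def measuredRate (D : (Fin 2 → ℝ) → (Fin 2 → ℝ) → EReal) (ρ σ : ∀ n, Op (Fin (N n)))
    (l k n : ℕ) : EReal :=
  ((((n : ℝ) ^ k)⁻¹ : ℝ) : EReal) * measuredDivergence D
    (tensorPow (ρ n) (n ^ k)) (tensorPow (σ n) (n ^ k)) (n ^ (k * l))

/-- `f` is the computational relative entropy of `ρ` and `σ`. -/
def IsCompRelEntropy (ρ σ : ∀ n, Op (Fin (N n))) (f : ℕ → ℝ) : Prop :=
  IsLimLimLiminf (testingRate ρ σ) f

/-- `f` is the computational two-outcome measured relative entropy of `ρ` and `σ`. -/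
def IsCompMeasuredRelEntropy (ρ σ : ∀ n, Op (Fin (N n))) (f : ℕ → ℝ) : Prop :=
  IsLimLiminf (measuredRate relEntropy ρ σ) f

/-- The computational two-outcome measured max-relative entropy is `≲ O(poly(n))`. -/
def CompMeasuredMaxRelEntropyPolyBounded (ρ σ : ∀ n, Op (Fin (N n))) : Prop :=
  ∃ p : ℕ → ℝ, PolyBounded p ∧ LimLiminfLE (measuredRate maxRelEntropy ρ σ) p

end

end CompStein

/-! The proof rests on two one-shot inequalities.

Converse (`le_measuredDivergence_relEntropy`): a test of complexity `G` is one outcome of a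
two-outcome measurement of complexity polynomial in `G` and the number of qubits, so data processing
gives `(1 - ε) D_h^ε - log 2` as a lower bound for the measured relative entropy. The number of
ancillas is unbounded, but a circuit of `G` gates touches at most `2G` qubits and the other ancillas
stay zero.

Achievability (`le_hypothesisTestingRelEntropy`): apply a good two-outcome measurement to each of
`m` independent blocks and perform a likelihood-ratio test on the outcomes. With two outcomes the
log-likelihood ratio is affine in the number of occurrences of one of them, so the test only
compares a count with a threshold, which `O(m²)` gates can do (`exists_threshold_circuit`).
Chebyshev's inequality (`exists_threshold_test`) bounds the type I error; the variance is controlled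
by the max-relative entropy.

The hypothesis on the max-relative entropy concerns a limit. Superadditivity
(`le_measuredDivergence_maxRelEntropy`) turns it into a bound `n^d` valid for each fixed `ℓ`, `k`
and all large `n` (`exists_pow_bound_measuredRate_max`).

Limits inferior are known only through their upper bounds, so both inequalities are stated as
transport of upper bounds: from testing to measured rates (`LiminfLE.measuredRate_of_testingRate`)
and back (`LiminfLE.testingRate_of_small`, `LiminfLE.testingRate_const`). The complexity overhead
replaces `ℓ` by `ℓ + 10` or `2ℓ + const`, which the outer limit does not see. The factor `1 - ε` of
the converse costs about `ε n^d`, which tends to zero in the pseudometric as `ε` does; for constant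
`ε` it remains as `1 / (1 - ε)`. -/

namespace CompStein

/-! ### Circuits of two-local gates and the Toffoli gate -/

section Gates

variable {ι : Type} [Fintype ι] [DecidableEq ι]

/-- `U` is a product of at most `c` two-local unitaries. -/
def HasCircuit (c : ℕ) (U : Op ι) : Prop :=
  ∃ L : List (Op ι), (∀ g ∈ L, IsTwoLocal g) ∧ L.length ≤ c ∧ L.prod = U

theorem gateComplexity_le_iff {U : Op ι} {c : ℕ} :
    gateComplexity U ≤ c ↔ HasCircuit c U := by
  constructor
  · intro h
    -- A strict bound on the infimum yields a circuit without a separate proof that the minimum is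
    -- attained.
    have h1 : gateComplexity U < (c + 1 : ℕ) :=
      lt_of_le_of_lt h (by exact_mod_cast Nat.lt_succ_self c)
    unfold gateComplexity at h1
    rw [iInf_lt_iff] at h1
    obtain ⟨L, hL⟩ := h1
    rw [iInf_lt_iff] at hL
    obtain ⟨⟨h2, h3⟩, h4⟩ := hL
    refine ⟨L, h2, ?_, h3⟩
    have : L.length < c + 1 := by exact_mod_cast h4
    omega
  · rintro ⟨L, h1, h2, h3⟩
    exact (iInf₂_le L ⟨h1, h3⟩).trans (by exact_mod_cast h2)

theorem HasCircuit.one : HasCircuit 0 (1 : Op ι) := ⟨[], by simp, by simp, by simp⟩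

theorem HasCircuit.mul {c d : ℕ} {U V : Op ι} (hU : HasCircuit c U) (hV : HasCircuit d V) :
    HasCircuit (c + d) (U * V) := by
  obtain ⟨L, h1, h2, h3⟩ := hU
  obtain ⟨L', h1', h2', h3'⟩ := hV
  refine ⟨L ++ L', ?_, ?_, ?_⟩
  · intro g hg
    rcases List.mem_append.1 hg with h | h
    exacts [h1 g h, h1' g h]
  · rw [List.length_append]; omega
  · rw [List.prod_append, h3, h3']

theorem HasCircuit.mono {c d : ℕ} {U : Op ι} (hU : HasCircuit c U) (h : c ≤ d) :
    HasCircuit d U := by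
  obtain ⟨L, h1, h2, h3⟩ := hU
  exact ⟨L, h1, h2.trans h, h3⟩

theorem IsTwoLocal.hasCircuit {g : Op ι} (hg : IsTwoLocal g) : HasCircuit 1 g :=
  ⟨[g], by simpa using hg, by simp, by simp⟩

/-- The operator that pulls functions back along `g`; a permutation matrix if `g` is bijective. -/
def permOp (g : (ι → Fin 2) → (ι → Fin 2)) : Op ι :=
  Matrix.of fun x y => if g x = y then 1 else 0

theorem permOp_mul_apply (g : (ι → Fin 2) → (ι → Fin 2)) (M : Op ι) (x y : ι → Fin 2) :
    (permOp g * M) x y = M (g x) y := by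
  simp [Matrix.mul_apply, permOp]

theorem permOp_id : permOp (fun x : ι → Fin 2 => x) = 1 := by
  ext x y
  simp [permOp, Matrix.one_apply]

theorem permOp_mul_permOp (g h : (ι → Fin 2) → (ι → Fin 2)) :
    permOp g * permOp h = permOp (fun x => h (g x)) := by
  ext x y
  rw [permOp_mul_apply]
  rfl

/-- The operator `W x` on the qubit `t`, controlled on the other qubits. -/
def condOp (t : ι) (W : (ι → Fin 2) → Matrix (Fin 2) (Fin 2) ℂ) : Op ι :=
  Matrix.of fun x y => if ∀ q, q ≠ t → x q = y q then W x (x t) (y t) else 0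

theorem condOp_mul (t : ι) (W W' : (ι → Fin 2) → Matrix (Fin 2) (Fin 2) ℂ)
    (hW' : ∀ x b, W' (Function.update x t b) = W' x) :
    condOp t W * condOp t W' = condOp t (fun x => W x * W' x) := by
  ext x y
  rw [Matrix.mul_apply]
  rw [← Fintype.sum_of_injective (fun b : Fin 2 => Function.update x t b)
    (Function.update_injective x t)
    (fun b => W x (x t) b * condOp t W' (Function.update x t b) y)]
  · by_cases h : ∀ q, q ≠ t → x q = y q
    · have h' : ∀ b, ∀ q, q ≠ t → Function.update x t b q = y q := by
        intro b q hq
        rw [Function.update_of_ne hq]; exact h q hq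
      simp only [condOp, Matrix.of_apply, if_pos h, if_pos (h' _), hW', Function.update_self,
        Matrix.mul_apply]
    · have h' : ∀ b, ¬ ∀ q, q ≠ t → Function.update x t b q = y q := by
        intro b hb
        apply h
        intro q hq
        have := hb q hq
        rwa [Function.update_of_ne hq] at this
      simp only [condOp, Matrix.of_apply, if_neg h, if_neg (h' _), mul_zero,
        Finset.sum_const_zero]
  · intro z hz
    have : ¬ ∀ q, q ≠ t → x q = z q := by
      intro h
      apply hz
      refine ⟨z t, ?_⟩
      ext q
      by_cases hq : q = t
      · subst hq; simp
      · simp only [Function.update_of_ne hq, h q hq]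
    simp only [condOp, Matrix.of_apply, if_neg this, zero_mul]
  · intro b
    have : ∀ q, q ≠ t → x q = Function.update x t b q := by
      intro q hq; rw [Function.update_of_ne hq]
    simp only [condOp, Matrix.of_apply, if_pos this, Function.update_self]

theorem isTwoLocal_condOp {i t : ι} (h : i ≠ t) (W : Fin 2 → Matrix (Fin 2) (Fin 2) ℂ)
    (hW : ∀ a, W a * (W a).conjTranspose = 1) :
    IsTwoLocal (condOp t (fun x : ι → Fin 2 => W (x i))) := by
  refine ⟨i, t, h, Matrix.of fun p q => if p.1 = q.1 then W p.1 p.2 q.2 else 0, ?_, ?_⟩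
  · rw [Matrix.mem_unitaryGroup_iff]
    ext ⟨a, b⟩ ⟨a', b'⟩
    have h1 := fun b b' => congrFun (congrFun (hW a) b) b'
    simp only [Matrix.mul_apply, Matrix.conjTranspose_apply] at h1
    simp only [Matrix.mul_apply, Fintype.sum_prod_type, Matrix.star_apply, Matrix.of_apply,
      Matrix.one_apply, Prod.mk.injEq]
    rw [Finset.sum_eq_single a]
    · by_cases haa : a' = a
      · subst haa
        simp only [if_true, true_and]
        rw [h1 b b', Matrix.one_apply]
      · simp [haa, Ne.symm haa]
    · intro c _ hc
      simp [Ne.symm hc]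
    · simp
  · intro x y
    simp only [condOp, Matrix.of_apply]
    by_cases h1 : x i = y i
    · simp only [h1, if_true]
      congr 1
      apply propext
      constructor
      · intro h2 q _ hq; exact h2 q hq
      · intro h2 q hq
        by_cases hqi : q = i
        · rw [hqi, h1]
        · exact h2 q hqi hq
    · simp only [h1, if_false, ite_self]
      rw [if_neg]
      intro h2
      exact h1 (h2 i h)

/-- A square root of the Pauli matrix `X`. -/
noncomputable def sqrtX : Matrix (Fin 2) (Fin 2) ℂ :=
  !![(1 + Complex.I) / 2, (1 - Complex.I) / 2; (1 - Complex.I) / 2, (1 + Complex.I) / 2]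

/-- `X ^ c`. -/
def powX (c : Fin 2) : Matrix (Fin 2) (Fin 2) ℂ := Matrix.of fun s s' => if s + c = s' then 1 else 0

theorem sqrtX_mul_conjTranspose : sqrtX * sqrtX.conjTranspose = 1 := by
  ext i j
  fin_cases i <;> fin_cases j <;>
    simp [sqrtX, Matrix.mul_apply, Fin.sum_univ_two, Complex.ext_iff, Complex.conj_ofNat] <;>
    norm_num

theorem conjTranspose_mul_sqrtX : sqrtX.conjTranspose * sqrtX = 1 :=
  mul_eq_one_comm.1 sqrtX_mul_conjTranspose

theorem sqrtX_mul_self : sqrtX * sqrtX = powX 1 := by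
  ext i j
  fin_cases i <;> fin_cases j <;>
    simp [sqrtX, powX, Matrix.mul_apply, Fin.sum_univ_two, Complex.ext_iff] <;> norm_num

theorem powX_zero : powX 0 = 1 := by
  ext i j
  simp [powX, Matrix.one_apply]

theorem powX_mul (a b : Fin 2) : powX a * powX b = powX (a + b) := by
  ext i j
  fin_cases a <;> fin_cases b <;> fin_cases i <;> fin_cases j <;>
    simp [powX, Matrix.mul_apply]

theorem powX_conjTranspose (a : Fin 2) : (powX a).conjTranspose = powX a := by
  ext i j
  fin_cases a <;> fin_cases i <;> fin_cases j <;> simp [powX]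

theorem powX_unitary (a : Fin 2) : powX a * (powX a).conjTranspose = 1 := by
  rw [powX_conjTranspose, powX_mul, ← powX_zero]
  congr 1
  revert a; decide

/-- `√X ^ a`. -/
noncomputable def powSqrtX (a : Fin 2) : Matrix (Fin 2) (Fin 2) ℂ := if a = 0 then 1 else sqrtX

theorem powSqrtX_unitary (a : Fin 2) : powSqrtX a * (powSqrtX a).conjTranspose = 1 := by
  unfold powSqrtX
  split_ifs
  · simp
  · exact sqrtX_mul_conjTranspose

theorem powSqrtX_unitary' (a : Fin 2) : (powSqrtX a).conjTranspose * powSqrtX a = 1 :=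
  mul_eq_one_comm.1 (powSqrtX_unitary a)

/-- For bits, the integer `a + b - (a xor b)` equals `2ab`, so the powers of the square root of `X`
combine to `X ^ (ab)`. -/
theorem powSqrtX_toffoli (a b : Fin 2) :
    powSqrtX b * (powSqrtX (a + b)).conjTranspose * powSqrtX a = powX (a * b) := by
  have h2 : (1 : Fin 2) + 1 = 0 := rfl
  fin_cases a <;> fin_cases b <;>
    simp [powSqrtX, powX_zero, h2, sqrtX_mul_self, sqrtX_mul_conjTranspose,
      conjTranspose_mul_sqrtX]

theorem condOp_powX (t : ι) (φ : (ι → Fin 2) → Fin 2) :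
    condOp t (fun x => powX (φ x)) = permOp (fun x => Function.update x t (x t + φ x)) := by
  ext x y
  simp only [condOp, permOp, powX, Matrix.of_apply]
  by_cases h : ∀ q, q ≠ t → x q = y q
  · rw [if_pos h]
    congr 1
    apply propext
    constructor
    · intro h1
      ext q
      by_cases hq : q = t
      · subst hq; rw [Function.update_self, h1]
      · rw [Function.update_of_ne hq, h q hq]
    · intro h1
      rw [← h1, Function.update_self]
  · rw [if_neg h, if_neg]
    intro h1
    apply h
    intro q hq
    rw [← h1, Function.update_of_ne hq]

/-- An involution that leaves the target alone only changes what the operator is controlled on. With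
a CNOT between two controls, a two-qubit gate becomes controlled on the sum of two bits. -/
theorem permOp_mul_condOp_mul_permOp {t : ι} (W : (ι → Fin 2) → Matrix (Fin 2) (Fin 2) ℂ)
    (g : (ι → Fin 2) → (ι → Fin 2)) (hg : ∀ x, g (g x) = x) (hgt : ∀ x, g x t = x t)
    (hgu : ∀ x y, (∀ q, q ≠ t → x q = y q) → ∀ q, q ≠ t → g x q = g y q) :
    permOp g * condOp t W * permOp g = condOp t (fun x => W (g x)) := by
  ext x y
  rw [Matrix.mul_assoc, permOp_mul_apply, Matrix.mul_apply, Finset.sum_eq_single (g y)]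
  · simp only [permOp, Matrix.of_apply, hg, if_true, mul_one, condOp, hgt]
    congr 1
    apply propext
    constructor
    · intro h
      have := hgu _ _ h
      simpa only [hg] using this
    · exact hgu x y
  · intro z _ hz
    have : g z ≠ y := by
      rintro rfl
      exact hz (hg z).symm
    simp [permOp, this]
  · simp

/-- The five-gate Toffoli: two controlled roots of `X`, and one controlled inverse root between two
CNOTs. Negations of the controls and of the result are absorbed into these gates at no cost. -/
theorem hasCircuit_and {i j t : ι} (hij : i ≠ j) (hit : i ≠ t) (hjt : j ≠ t) (α β γ : Fin 2) :
    HasCircuit 5 (permOp (fun x : ι → Fin 2 =>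
      Function.update x t (x t + ((x i + α) * (x j + β) + γ)))) := by
  have h2 : ∀ a : Fin 2, a + a = 0 := by decide
  set P := permOp (fun x : ι → Fin 2 => Function.update x j (x j + (x i + α))) with hP
  have h1 : IsTwoLocal P := by
    rw [hP, ← condOp_powX j (fun x => x i + α)]
    exact isTwoLocal_condOp hij (fun a => powX (a + α)) (fun a => powX_unitary _)
  have hA : IsTwoLocal (condOp t (fun x : ι → Fin 2 => powSqrtX (x j + β))) :=
    isTwoLocal_condOp hjt (fun a => powSqrtX (a + β)) (fun a => powSqrtX_unitary _)
  have hB : IsTwoLocal (condOp t (fun x : ι → Fin 2 => (powSqrtX (x j + β)).conjTranspose)) :=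
    isTwoLocal_condOp hjt (fun a => (powSqrtX (a + β)).conjTranspose)
      (fun a => by rw [Matrix.conjTranspose_conjTranspose]; exact powSqrtX_unitary' _)
  have hC : IsTwoLocal (condOp t (fun x : ι → Fin 2 => powSqrtX (x i + α) * powX γ)) :=
    isTwoLocal_condOp hit (fun a => powSqrtX (a + α) * powX γ) (fun a => by
      rw [Matrix.conjTranspose_mul, Matrix.mul_assoc, ← Matrix.mul_assoc (powX γ),
        powX_unitary, Matrix.one_mul, powSqrtX_unitary])
  have key := ((hA.hasCircuit.mul (h1.hasCircuit.mul hB.hasCircuit |>.mul h1.hasCircuit)).mul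
    hC.hasCircuit)
  rw [hP, permOp_mul_condOp_mul_permOp, condOp_mul, condOp_mul] at key
  · convert key using 1
    rw [← condOp_powX t (fun x => (x i + α) * (x j + β) + γ)]
    congr 1
    ext1 x
    rw [← powX_mul, ← powSqrtX_toffoli, Function.update_self]
    have : x j + (x i + α) + β = x i + α + (x j + β) := by abel
    rw [this]
    simp only [Matrix.mul_assoc]
  · intro x b
    rw [Function.update_of_ne hit]
  · intro x b
    rw [Function.update_self, Function.update_self, Function.update_of_ne hit,
      Function.update_of_ne hjt]
  · intro x
    ext q
    by_cases hq : q = j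
    · subst hq
      rw [Function.update_self, Function.update_self, Function.update_of_ne hij, add_assoc, h2,
        add_zero]
    · rw [Function.update_of_ne hq, Function.update_of_ne hq]
  · intro x
    rw [Function.update_of_ne hjt.symm]
  · intro x y h q hq
    by_cases hqj : q = j
    · subst hqj
      rw [Function.update_self, Function.update_self, h q hq, h i hit]
    · rw [Function.update_of_ne hqj, Function.update_of_ne hqj, h q hq]

/-- Every gate acts on two distinct qubits, so even a NOT needs an idle partner `i`. -/
theorem hasCircuit_not {i t : ι} (hit : i ≠ t) (γ : Fin 2) :
    HasCircuit 1 (permOp (fun x : ι → Fin 2 => Function.update x t (x t + γ))) := by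
  rw [← condOp_powX t (fun _ => γ)]
  exact (isTwoLocal_condOp hit (fun _ => powX γ) (fun a => powX_unitary _)).hasCircuit

end Gates

end CompStein

namespace CompStein

/-! ### Reversible circuits for threshold functions -/

section Threshold

variable {κ : Type} [Fintype κ] [DecidableEq κ] {S : ℕ}

/-- The basis state `|z⟩|0…0⟩`. -/
def withZeros {α : Type} (z : κ → Fin 2) : κ ⊕ α → Fin 2 := Sum.elim z fun _ => 0

/-- `g` acts as a reversible circuit of `s` gates that uses only the first `s` ancillas and does
not change the input. -/
structure IsProgram (s : ℕ) (g : (κ ⊕ Fin S → Fin 2) → (κ ⊕ Fin S → Fin 2)) : Prop where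
  circuit : HasCircuit (5 * s) (permOp g)
  keep : ∀ z w, g (withZeros z) (Sum.inl w) = z w
  fresh : ∀ z (j : Fin S), s ≤ j → g (withZeros z) (Sum.inr j) = 0

/-- After `g`, the function `f` of the input is constant or stored, up to negation, on a wire
that is in use. -/
def OnWire (s : ℕ) (g : (κ ⊕ Fin S → Fin 2) → (κ ⊕ Fin S → Fin 2))
    (f : (κ → Fin 2) → Fin 2) : Prop :=
  (∃ c, ∀ z, f z = c) ∨ ∃ (w : κ ⊕ Fin S) (α : Fin 2), (∀ j : Fin S, w = Sum.inr j → (j : ℕ) < s) ∧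
    ∀ z, f z = g (withZeros z) w + α

theorem IsProgram.mono {s s' : ℕ} {g : (κ ⊕ Fin S → Fin 2) → (κ ⊕ Fin S → Fin 2)}
    (hg : IsProgram s g) (h : s ≤ s') : IsProgram s' g :=
  ⟨hg.circuit.mono (by omega), hg.keep, fun z j hj => hg.fresh z j (h.trans hj)⟩

theorem OnWire.mono {s s' : ℕ} {g : (κ ⊕ Fin S → Fin 2) → (κ ⊕ Fin S → Fin 2)}
    {f : (κ → Fin 2) → Fin 2} (hf : OnWire s g f) (h : s ≤ s') : OnWire s' g f := by
  rcases hf with hf | ⟨w, α, h1, h2⟩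
  · exact Or.inl hf
  · exact Or.inr ⟨w, α, fun j hj => (h1 j hj).trans_le h, h2⟩

theorem isProgram_id : IsProgram 0 (fun x : κ ⊕ Fin S → Fin 2 => x) :=
  ⟨by rw [permOp_id]; exact HasCircuit.one, fun _ _ => rfl, fun _ _ _ => rfl⟩

theorem OnWire.add_const {s : ℕ} {g : (κ ⊕ Fin S → Fin 2) → (κ ⊕ Fin S → Fin 2)}
    {f : (κ → Fin 2) → Fin 2} (hf : OnWire s g f) (β : Fin 2) :
    OnWire s g (fun z => f z + β) := by
  rcases hf with ⟨c, hf⟩ | ⟨w, α, h1, h2⟩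
  · exact Or.inl ⟨c + β, fun z => by beta_reduce; rw [hf]⟩
  · exact Or.inr ⟨w, α + β, h1, fun z => by beta_reduce; rw [h2, add_assoc]⟩

theorem IsProgram.onWire_input {s : ℕ} {g : (κ ⊕ Fin S → Fin 2) → (κ ⊕ Fin S → Fin 2)}
    (hg : IsProgram s g) (w : κ) (α : Fin 2) : OnWire s g (fun z => z w + α) :=
  Or.inr ⟨Sum.inl w, α, by simp, fun z => by beta_reduce; rw [hg.keep]⟩

/-- One Toffoli gate writes the product to the next ancilla and overwrites nothing, so earlier
values stay available. The gate needs three distinct wires; if a factor is constant or both factors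
sit on one wire, the product is already constant or on a wire. -/
theorem IsProgram.exists_mul {s : ℕ} {g : (κ ⊕ Fin S → Fin 2) → (κ ⊕ Fin S → Fin 2)}
    (hg : IsProgram s g) (hs : s < S) {f₁ f₂ : (κ → Fin 2) → Fin 2}
    (h₁ : OnWire s g f₁) (h₂ : OnWire s g f₂) :
    ∃ g' : (κ ⊕ Fin S → Fin 2) → (κ ⊕ Fin S → Fin 2), IsProgram (s + 1) g' ∧ OnWire (s + 1) g' (fun z => f₁ z * f₂ z) ∧
      ∀ f, OnWire s g f → OnWire (s + 1) g' f := by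
  have trivial_case : OnWire s g (fun z => f₁ z * f₂ z) →
      ∃ g' : (κ ⊕ Fin S → Fin 2) → (κ ⊕ Fin S → Fin 2), IsProgram (s + 1) g' ∧ OnWire (s + 1) g' (fun z => f₁ z * f₂ z) ∧
      ∀ f, OnWire s g f → OnWire (s + 1) g' f := fun h =>
    ⟨g, hg.mono (Nat.le_succ s), h.mono (Nat.le_succ s), fun f hf => hf.mono (Nat.le_succ s)⟩
  have h01 : ∀ c : Fin 2, c = 0 ∨ c = 1 := by decide
  rcases h₁ with ⟨c, h₁⟩ | ⟨w₁, α, hw₁, h₁⟩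
  · apply trivial_case
    rcases h01 c with rfl | rfl
    · exact Or.inl ⟨0, fun z => by beta_reduce; rw [h₁, zero_mul]⟩
    · convert h₂ using 2 with z
      rw [h₁, one_mul]
  rcases h₂ with ⟨c, h₂⟩ | ⟨w₂, β, hw₂, h₂⟩
  · apply trivial_case
    rcases h01 c with rfl | rfl
    · exact Or.inl ⟨0, fun z => by beta_reduce; rw [h₂, mul_zero]⟩
    · refine Or.inr ⟨w₁, α, hw₁, fun z => ?_⟩
      beta_reduce
      rw [h₂, mul_one, h₁]
  by_cases hw : w₁ = w₂
  · apply trivial_case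
    subst hw
    by_cases hαβ : α = β
    · subst hαβ
      refine Or.inr ⟨w₁, α, hw₁, fun z => ?_⟩
      beta_reduce
      rw [h₁, h₂]
      generalize g (withZeros z) w₁ + α = c
      revert c; decide
    · refine Or.inl ⟨0, fun z => ?_⟩
      beta_reduce
      rw [h₁, h₂]
      generalize g (withZeros z) w₁ = c
      clear h₁ h₂
      revert c α β; decide
  -- The ancilla with index `s` is still zero, so adding the product to it stores the product.
  set t : κ ⊕ Fin S := Sum.inr ⟨s, hs⟩ with ht
  have ht₁ : w₁ ≠ t := fun h => (lt_irrefl _ (hw₁ ⟨s, hs⟩ h))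
  have ht₂ : w₂ ≠ t := fun h => (lt_irrefl _ (hw₂ ⟨s, hs⟩ h))
  refine ⟨fun x => Function.update (g x) t (g x t + ((g x w₁ + α) * (g x w₂ + β) + 0)),
    ⟨?_, ?_, ?_⟩, Or.inr ⟨t, 0, ?_, ?_⟩, ?_⟩
  · have := hg.circuit.mul (hasCircuit_and hw ht₁ ht₂ α β 0)
    rw [permOp_mul_permOp] at this
    exact this.mono (by omega)
  · intro z w
    rw [Function.update_of_ne (by simp [ht]), hg.keep]
  · intro z j hj
    rw [Function.update_of_ne, hg.fresh z j (by omega)]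
    intro h
    have := Sum.inr_injective h
    rw [this] at hj
    simp at hj
  · intro j hj
    rw [← Sum.inr_injective hj]; simp
  · intro z
    beta_reduce
    rw [Function.update_self, hg.fresh z ⟨s, hs⟩ le_rfl, h₁, h₂]
    simp
  · rintro f (hf | ⟨w, γ, hw', hf⟩)
    · exact Or.inl hf
    · refine Or.inr ⟨w, γ, fun j hj => (hw' j hj).trans (Nat.lt_succ_self s), fun z => ?_⟩
      beta_reduce
      rw [Function.update_of_ne, hf]
      intro h
      exact lt_irrefl _ (hw' ⟨s, hs⟩ h)

/-- `[j ≤ number of ones among the values at z of the functions in l]`. -/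
def threshold (l : List ((κ → Fin 2) → Fin 2)) (j : ℕ) (z : κ → Fin 2) : Fin 2 :=
  if j ≤ l.countP (fun b => b z = 1) then 1 else 0

/-- Either `l` already has `j + 1` ones, or it has `j` and `b` is one; the disjunction is written
with De Morgan's law over the field with two elements. This costs two products. -/
theorem threshold_cons (b : (κ → Fin 2) → Fin 2) (l : List ((κ → Fin 2) → Fin 2)) (j : ℕ)
    (z : κ → Fin 2) :
    threshold (b :: l) (j + 1) z =
      (threshold l (j + 1) z + 1) * (threshold l j z * b z + 1) + 1 := by
  unfold threshold
  rw [List.countP_cons]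
  generalize List.countP (fun b => decide (b z = 1)) l = c
  have h01 : b z = 0 ∨ b z = 1 := by generalize b z = c; revert c; decide
  rcases lt_trichotomy j c with h | h | h
  · rw [if_pos (by omega), if_pos (by omega), if_pos (by omega)]
    rcases h01 with h0 | h0 <;> rw [h0] <;> decide
  · rcases h01 with h0 | h0
    · rw [h0, if_neg (by simp; omega), if_neg (by omega)]; simp
    · rw [h0, if_pos (by simp; omega), if_neg (by omega), if_pos (by omega)]; decide
  · rw [if_neg (by split_ifs <;> omega), if_neg (by omega), if_neg (by omega)]; simp

/-- Dynamic programming: the thresholds up to `T` for the tail determine those for the whole list,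
at two products per threshold by `threshold_cons`. -/
theorem exists_program_threshold (T : ℕ) (l : List ((κ → Fin 2) → Fin 2))
    (hl : ∀ b ∈ l, ∃ w α, b = fun z => z w + α) (hS : l.length * (2 * T) ≤ S) :
    ∃ g : (κ ⊕ Fin S → Fin 2) → (κ ⊕ Fin S → Fin 2), IsProgram (l.length * (2 * T)) g ∧
      ∀ j ≤ T, OnWire (l.length * (2 * T)) g (threshold l j) := by
  induction l with
  | nil =>
    refine ⟨fun x => x, by simpa using isProgram_id, fun j _ => Or.inl ?_⟩
    exact ⟨if j ≤ 0 then 1 else 0, fun z => rfl⟩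
  | cons b l ih =>
    have hlen : (b :: l).length * (2 * T) = l.length * (2 * T) + 2 * T := by
      rw [List.length_cons]; ring
    rw [hlen] at hS ⊢
    obtain ⟨g, hg, hgT⟩ := ih (fun b hb => hl b (List.mem_cons_of_mem _ hb)) (by omega)
    set s := l.length * (2 * T) with hs
    have key : ∀ J ≤ T, ∃ g' : (κ ⊕ Fin S → Fin 2) → (κ ⊕ Fin S → Fin 2),
        IsProgram (s + 2 * J) g' ∧ (∀ f, OnWire s g f → OnWire (s + 2 * J) g' f) ∧
        ∀ j ≤ J, OnWire (s + 2 * J) g' (threshold (b :: l) j) := by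
      intro J
      induction J with
      | zero =>
        intro _
        refine ⟨g, hg, fun f hf => hf, fun j hj => Or.inl ⟨1, fun z => ?_⟩⟩
        rw [Nat.le_zero.1 hj]
        simp [threshold]
      | succ J ihJ =>
        intro hJ
        obtain ⟨g₁, hg₁, hold₁, hthr₁⟩ := ihJ (by omega)
        obtain ⟨w, α, rfl⟩ := hl b List.mem_cons_self
        obtain ⟨g₂, hg₂, hnew₂, hold₂⟩ := hg₁.exists_mul (by omega)
          (hold₁ _ (hgT J (by omega))) (hg₁.onWire_input w α)
        obtain ⟨g₃, hg₃, hnew₃, hold₃⟩ := hg₂.exists_mul (by omega)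
          (hold₂ _ ((hold₁ _ (hgT (J + 1) (by omega))).add_const 1)) (hnew₂.add_const 1)
        refine ⟨g₃, hg₃, fun f hf => hold₃ _ (hold₂ _ (hold₁ _ hf)), fun j hj => ?_⟩
        rcases Nat.lt_or_ge j (J + 1) with h | h
        · exact hold₃ _ (hold₂ _ (hthr₁ j (by omega)))
        · obtain rfl : j = J + 1 := by omega
          have h4 : OnWire (s + 2 * (J + 1)) g₃ _ := hnew₃.add_const 1
          convert h4 using 2 with z
          exact threshold_cons _ _ _ _
    obtain ⟨g', hg', -, hthr⟩ := key T le_rfl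
    exact ⟨g', hg', hthr⟩

/-- A circuit with `O(m T)` gates decides whether at least `T` of `m` bits have given values. -/
theorem exists_threshold_circuit {J : Type} [Fintype J] (w : J → κ) (α : J → Fin 2) (T : ℕ) :
    ∃ (S : ℕ) (g : (κ ⊕ Fin S → Fin 2) → (κ ⊕ Fin S → Fin 2)) (v : κ ⊕ Fin S),
      HasCircuit (10 * (Fintype.card J * T) + 1) (permOp g) ∧
      ∀ z, g (withZeros z) v = 0 ↔ T ≤ (Finset.univ.filter fun j => z (w j) = α j).card := by
  classical
  set l : List ((κ → Fin 2) → Fin 2) :=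
    (Finset.univ : Finset J).toList.map (fun j z => z (w j) + (α j + 1)) with hl
  have hlen : l.length = Fintype.card J := by simp [hl]
  have hcount : ∀ z, l.countP (fun b => b z = 1) =
      (Finset.univ.filter fun j => z (w j) = α j).card := by
    intro z
    rw [hl, List.countP_map, Finset.card_filter, ← Finset.sum_map_toList]
    generalize (Finset.univ : Finset J).toList = L
    induction L with
    | nil => simp
    | cons j L ih =>
      rw [List.countP_cons, ih, List.map_cons, List.sum_cons, add_comm]
      congr 1
      have : (z (w j) + (α j + 1) = 1) ↔ z (w j) = α j := by
        generalize z (w j) = a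
        generalize α j = b
        revert a b; decide
      simp [this]
  -- The two spare ancillas provide a zero wire in case the threshold is constant, and a partner
  -- qubit for the final NOT.
  obtain ⟨g, hg, hthr⟩ := exists_program_threshold (κ := κ) (S := l.length * (2 * T) + 2) T l (by
    intro b hb
    rw [hl, List.mem_map] at hb
    obtain ⟨j, -, rfl⟩ := hb
    exact ⟨w j, α j + 1, rfl⟩) (Nat.le_add_right _ _)
  have main : ∃ v γ, ∀ z, threshold l T z = g (withZeros z) v + γ := by
    rcases hthr T le_rfl with ⟨c, hc⟩ | ⟨v, γ, -, hv⟩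
    · refine ⟨Sum.inr (Fin.last _), c, fun z => ?_⟩
      rw [hg.fresh z _ (by simp), hc, zero_add]
    · exact ⟨v, γ, hv⟩
  obtain ⟨v, γ, hv⟩ := main
  obtain ⟨u, hu⟩ : ∃ u : κ ⊕ Fin (l.length * (2 * T) + 2), u ≠ v := by
    by_cases h : v = Sum.inr 0
    · exact ⟨Sum.inr 1, by rw [h]; simp⟩
    · exact ⟨Sum.inr 0, Ne.symm h⟩
  -- The extra `1` makes acceptance correspond to the value zero, since effects may only project
  -- onto `|0⟩`.
  refine ⟨_, fun x => Function.update (g x) v (g x v + (γ + 1)), v, ?_, fun z => ?_⟩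
  · have := hg.circuit.mul (hasCircuit_not hu (γ + 1))
    rw [permOp_mul_permOp] at this
    refine this.mono ?_
    rw [hlen]
    apply le_of_eq
    ring
  · beta_reduce
    rw [Function.update_self, ← add_assoc, ← hv, threshold, hcount]
    split_ifs with h <;> simp [h]

end Threshold

end CompStein

namespace CompStein

/-! ### Operators on part of a register, unitarity and supports of circuits -/

section Lift

variable {κ κ' : Type} [Fintype κ] [DecidableEq κ] [Fintype κ'] [DecidableEq κ']

open Classical in
/-- The operator `M` on the qubits in the range of `j`, tensored with the identity. -/
noncomputable def liftOp (j : κ → κ') (M : Op κ) : Op κ' :=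
  Matrix.of fun x y => if ∀ q, q ∉ Set.range j → x q = y q then M (x ∘ j) (y ∘ j) else 0

theorem liftOp_apply_of_eq {j : κ → κ'} (M : Op κ) {x y : κ' → Fin 2}
    (h : ∀ q, q ∉ Set.range j → x q = y q) : liftOp j M x y = M (x ∘ j) (y ∘ j) := by
  simp only [liftOp, Matrix.of_apply]
  rw [if_pos h]

theorem liftOp_apply_of_ne {j : κ → κ'} (M : Op κ) {x y : κ' → Fin 2}
    (h : ¬ ∀ q, q ∉ Set.range j → x q = y q) : liftOp j M x y = 0 := by
  simp only [liftOp, Matrix.of_apply]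
  rw [if_neg h]

theorem extend_agree (j : κ → κ') (x : κ' → Fin 2) (w : κ → Fin 2) :
    ∀ q, q ∉ Set.range j → x q = Function.extend j w x q := fun q hq =>
  (Function.extend_apply' _ _ _ (by simpa using hq)).symm

/-- Row `x` of the lifted operator is supported on the strings that agree with `x` off the range of
`j`; `Function.extend` parametrises them. -/
theorem sum_liftOp_mul {j : κ → κ'} (hj : Function.Injective j) (M : Op κ) (x : κ' → Fin 2)
    (F : (κ' → Fin 2) → ℂ) :
    ∑ z, liftOp j M x z * F z = ∑ w, M (x ∘ j) w * F (Function.extend j w x) := by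
  symm
  apply Fintype.sum_of_injective (fun w : κ → Fin 2 => Function.extend j w x)
  · intro w w' h
    have := congrArg (fun f => f ∘ j) h
    simpa only [Function.extend_comp hj] using this
  · intro z hz
    rw [liftOp_apply_of_ne, zero_mul]
    intro h
    apply hz
    refine ⟨z ∘ j, funext fun q => ?_⟩
    by_cases hq : q ∈ Set.range j
    · obtain ⟨k, rfl⟩ := hq
      simp [hj.extend_apply]
    · rw [← h q hq]
      exact (extend_agree j x _ q hq).symm
  · intro w
    rw [liftOp_apply_of_eq M (extend_agree j x w), Function.extend_comp hj]

theorem liftOp_mul {j : κ → κ'} (hj : Function.Injective j) (M M' : Op κ) :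
    liftOp j M * liftOp j M' = liftOp j (M * M') := by
  ext x y
  rw [Matrix.mul_apply, sum_liftOp_mul hj]
  by_cases h : ∀ q, q ∉ Set.range j → x q = y q
  · rw [liftOp_apply_of_eq _ h, Matrix.mul_apply]
    refine Finset.sum_congr rfl fun w _ => ?_
    rw [liftOp_apply_of_eq, Function.extend_comp hj]
    intro q hq
    rw [← extend_agree j x w q hq, h q hq]
  · rw [liftOp_apply_of_ne _ h]
    refine Finset.sum_eq_zero fun w _ => ?_
    rw [liftOp_apply_of_ne, mul_zero]
    intro h'
    apply h
    intro q hq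
    rw [extend_agree j x w q hq, h' q hq]

theorem liftOp_one (j : κ → κ') : liftOp j (1 : Op κ) = 1 := by
  ext x y
  by_cases h : ∀ q, q ∉ Set.range j → x q = y q
  · rw [liftOp_apply_of_eq _ h, Matrix.one_apply, Matrix.one_apply]
    congr 1
    apply propext
    constructor
    · intro h'
      ext q
      by_cases hq : q ∈ Set.range j
      · obtain ⟨k, rfl⟩ := hq
        exact congrArg Fin.val (congrFun h' k)
      · rw [h q hq]
    · rintro rfl; rfl
  · rw [liftOp_apply_of_ne _ h, Matrix.one_apply, if_neg]
    rintro rfl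
    exact h fun _ _ => rfl

theorem liftOp_conjTranspose (j : κ → κ') (M : Op κ) :
    (liftOp j M).conjTranspose = liftOp j M.conjTranspose := by
  ext x y
  rw [Matrix.conjTranspose_apply]
  by_cases h : ∀ q, q ∉ Set.range j → x q = y q
  · rw [liftOp_apply_of_eq _ h, liftOp_apply_of_eq _ fun q hq => (h q hq).symm,
      Matrix.conjTranspose_apply]
  · rw [liftOp_apply_of_ne _ h, liftOp_apply_of_ne, star_zero]
    exact fun h' => h fun q hq => (h' q hq).symm

theorem IsTwoLocal.lift {j : κ → κ'} (hj : Function.Injective j) {g : Op κ} (hg : IsTwoLocal g) :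
    IsTwoLocal (liftOp j g) := by
  obtain ⟨i, k, hik, V, hV, hg⟩ := hg
  refine ⟨j i, j k, hj.ne hik, V, hV, fun x y => ?_⟩
  by_cases h : ∀ q, q ∉ Set.range j → x q = y q
  · rw [liftOp_apply_of_eq _ h, hg]
    simp only [Function.comp_apply]
    congr 1
    apply propext
    constructor
    · intro h' q hq hq'
      by_cases hqr : q ∈ Set.range j
      · obtain ⟨l, rfl⟩ := hqr
        exact h' l (fun e => hq (by rw [e])) (fun e => hq' (by rw [e]))
      · exact h q hqr
    · intro h' q hq hq'
      exact h' (j q) (hj.ne hq) (hj.ne hq')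
  · rw [liftOp_apply_of_ne _ h, if_neg]
    intro h'
    apply h
    intro q hq
    exact h' q (fun e => hq ⟨i, e.symm⟩) (fun e => hq ⟨k, e.symm⟩)

theorem HasCircuit.lift {j : κ → κ'} (hj : Function.Injective j) {c : ℕ} {U : Op κ}
    (hU : HasCircuit c U) : HasCircuit c (liftOp j U) := by
  obtain ⟨L, h1, h2, rfl⟩ := hU
  refine ⟨L.map (liftOp j), ?_, by simpa using h2, ?_⟩
  · intro g hg
    rw [List.mem_map] at hg
    obtain ⟨g, hg, rfl⟩ := hg
    exact (h1 g hg).lift hj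
  · clear h1 h2
    induction L with
    | nil => simp [liftOp_one]
    | cons g L ih => rw [List.map_cons, List.prod_cons, List.prod_cons, ih, liftOp_mul hj]

theorem liftOp_equiv_apply (e : κ ≃ κ') (M : Op κ) (x y : κ' → Fin 2) :
    liftOp e M x y = M (x ∘ e) (y ∘ e) :=
  liftOp_apply_of_eq M fun q hq => (hq (e.surjective q)).elim

/-- The gate is the lift of its `4 × 4` unitary along the two qubits, and lifting respects products
and adjoints. -/
theorem IsTwoLocal.mul_conjTranspose {g : Op κ} (hg : IsTwoLocal g) :
    g * g.conjTranspose = 1 := by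
  obtain ⟨i, k, hik, V, hV, hg⟩ := hg
  set j : Fin 2 → κ := ![i, k] with hj
  have hinj : Function.Injective j := by
    intro a b hab
    fin_cases a <;> fin_cases b <;> simp_all
  set e : (Fin 2 → Fin 2) ≃ Fin 2 × Fin 2 := finTwoArrowEquiv (Fin 2)
  have key : g = liftOp j (V.submatrix e e) := by
    ext x y
    rw [hg]
    have hiff : (∀ q, q ∉ Set.range j → x q = y q) ↔ ∀ q, q ≠ i → q ≠ k → x q = y q := by
      refine forall_congr' fun q => ?_
      simp only [hj, Matrix.range_cons, Matrix.range_empty, Set.union_empty, Set.mem_union,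
        Set.mem_singleton_iff, not_or, and_imp]
    by_cases h : ∀ q, q ∉ Set.range j → x q = y q
    · rw [liftOp_apply_of_eq _ h, if_pos (hiff.1 h)]
      rfl
    · rw [liftOp_apply_of_ne _ h, if_neg (fun h' => h (hiff.2 h'))]
  rw [key, liftOp_conjTranspose, liftOp_mul hinj, Matrix.conjTranspose_submatrix,
    Matrix.submatrix_mul_equiv, ← liftOp_one j]
  congr 1
  rw [Matrix.mem_unitaryGroup_iff] at hV
  rw [← Matrix.star_eq_conjTranspose, hV, Matrix.submatrix_one_equiv]

theorem HasCircuit.mul_conjTranspose {c : ℕ} {U : Op κ} (hU : HasCircuit c U) :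
    U * U.conjTranspose = 1 := by
  obtain ⟨L, h1, -, rfl⟩ := hU
  induction L with
  | nil => simp
  | cons g L ih =>
    rw [List.prod_cons, Matrix.conjTranspose_mul, Matrix.mul_assoc, ← Matrix.mul_assoc L.prod,
      ih fun g hg => h1 g (List.mem_cons_of_mem _ hg), Matrix.one_mul,
      (h1 g List.mem_cons_self).mul_conjTranspose]

/-- If `g` identified two strings, the unitary matrix would have two equal rows, which contradicts
their orthogonality. -/
theorem HasCircuit.injective {c : ℕ} {g : (κ → Fin 2) → (κ → Fin 2)}
    (hg : HasCircuit c (permOp g)) : Function.Injective g := by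
  intro x y hxy
  by_contra hne
  have h := congrFun (congrFun hg.mul_conjTranspose x) y
  rw [permOp_mul_apply, Matrix.conjTranspose_apply, Matrix.one_apply, if_neg hne] at h
  simp [permOp, hxy] at h

theorem IsTwoLocal.apply_eq {g : Op κ} (hg : IsTwoLocal g) :
    ∃ s : Finset κ, s.card ≤ 2 ∧ ∀ x y, g x y ≠ 0 → ∀ q, q ∉ s → x q = y q := by
  obtain ⟨i, k, hik, V, hV, hg⟩ := hg
  refine ⟨{i, k}, Finset.card_le_two, fun x y h q hq => ?_⟩
  rw [hg] at h
  simp only [Finset.mem_insert, Finset.mem_singleton, not_or] at hq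
  by_contra hne
  rw [if_neg fun h' => hne (h' q hq.1 hq.2)] at h
  exact h rfl

/-- A circuit with `c` gates acts on at most `2c` qubits. -/
theorem HasCircuit.apply_eq {c : ℕ} {U : Op κ} (hU : HasCircuit c U) :
    ∃ s : Finset κ, s.card ≤ 2 * c ∧ ∀ x y, U x y ≠ 0 → ∀ q, q ∉ s → x q = y q := by
  obtain ⟨L, h1, h2, rfl⟩ := hU
  suffices h : ∃ s : Finset κ, s.card ≤ 2 * L.length ∧
      ∀ x y, L.prod x y ≠ 0 → ∀ q, q ∉ s → x q = y q by
    obtain ⟨s, hs, h⟩ := h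
    exact ⟨s, by omega, h⟩
  clear h2
  induction L with
  | nil =>
    refine ⟨∅, by simp, fun x y h q _ => ?_⟩
    rw [List.prod_nil, Matrix.one_apply] at h
    by_cases hxy : x = y
    · rw [hxy]
    · simp [hxy] at h
  | cons g L ih =>
    obtain ⟨s, hs, h⟩ := ih fun g hg => h1 g (List.mem_cons_of_mem _ hg)
    obtain ⟨s', hs', h'⟩ := (h1 g List.mem_cons_self).apply_eq
    refine ⟨s' ∪ s, (Finset.card_union_le _ _).trans (by rw [List.length_cons]; omega),
      fun x y hxy q hq => ?_⟩
    rw [List.prod_cons, Matrix.mul_apply] at hxy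
    obtain ⟨z, -, hz⟩ := Finset.exists_ne_zero_of_sum_ne_zero hxy
    rw [Finset.mem_union, not_or] at hq
    rw [h' x z (left_ne_zero_of_mul hz) q hq.1, h z y (right_ne_zero_of_mul hz) q hq.2]

theorem liftOp_mul_liftOp_of_compl {κ₁ κ₂ : Type} [Fintype κ₁] [DecidableEq κ₁] [Fintype κ₂]
    [DecidableEq κ₂] {j₁ : κ₁ → κ'} {j₂ : κ₂ → κ'} (h₁ : Function.Injective j₁)
    (h₁₂ : ∀ q, q ∉ Set.range j₂ ↔ q ∈ Set.range j₁)
    (A : Op κ₁) (B : Op κ₂) (x y : κ' → Fin 2) :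
    (liftOp j₁ A * liftOp j₂ B) x y = A (x ∘ j₁) (y ∘ j₁) * B (x ∘ j₂) (y ∘ j₂) := by
  rw [Matrix.mul_apply, sum_liftOp_mul h₁, Finset.sum_eq_single (y ∘ j₁)]
  · rw [liftOp_apply_of_eq]
    · congr 2
      ext k
      rw [Function.comp_apply, ← extend_agree]
      · rfl
      · intro h
        exact (h₁₂ _).2 h ⟨k, rfl⟩
    · intro q hq
      obtain ⟨k, rfl⟩ := (h₁₂ q).1 hq
      rw [h₁.extend_apply]; rfl
  · intro w _ hw
    rw [liftOp_apply_of_ne, mul_zero]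
    intro h
    apply hw
    ext k
    rw [← h₁.extend_apply w x k, h (j₁ k) ((h₁₂ _).2 ⟨k, rfl⟩)]
    rfl
  · simp

/-- The copies act on disjoint sets of qubits: the circuit on copy `0` and the circuit on the others
are lifts with complementary ranges, and their product is the tensor product. -/
theorem HasCircuit.tensorPow {c : ℕ} {U : Op κ} (hU : HasCircuit c U) (m : ℕ) :
    HasCircuit (m * c) (tensorPow U m) := by
  induction m with
  | zero =>
    have h : CompStein.tensorPow U 0 = 1 := by
      ext x y
      obtain rfl : x = y := by ext ⟨i, _⟩; exact i.elim0
      simp [CompStein.tensorPow]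
    rw [h, zero_mul]
    exact HasCircuit.one
  | succ m ih =>
    have h₁ : Function.Injective (fun k : κ => ((0 : Fin (m + 1)), k)) := fun k k' h => by
      simpa using h
    have h₂ : Function.Injective (fun p : Fin m × κ => (p.1.succ, p.2)) := by
      rintro ⟨i, k⟩ ⟨i', k'⟩ h
      simpa using h
    have := (hU.lift h₁).mul (ih.lift h₂)
    convert this using 1
    · ring
    · ext x y
      rw [liftOp_mul_liftOp_of_compl h₁]
      · simp only [CompStein.tensorPow, Matrix.of_apply, Fin.prod_univ_succ]
        rfl
      · rintro ⟨i, k⟩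
        refine Fin.cases ?_ (fun i => ?_) i
        · simp [Fin.succ_ne_zero]
        · simp [(Fin.succ_ne_zero i).symm]

end Lift

end CompStein

namespace CompStein

/-! ### Effects as classical postprocessing of a computational-basis measurement -/

section Effects

variable {ι α : Type} [Fintype ι] [DecidableEq ι] [Fintype α] [DecidableEq α]

open Classical in
/-- The effect "apply `U†` to the state with zeros on the ancillas, measure all qubits in the
computational basis, and accept if `f` holds for the outcome". -/
noncomputable def postEffect (U : Op (ι ⊕ α)) (f : (ι ⊕ α → Fin 2) → Prop) : Op ι :=
  Matrix.of fun x y => ∑ z, if f z then U (withZeros x) z * star (U (withZeros y) z) else 0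

/-- The probability of the outcome `z` if `U†` is applied to `ρ` with zeros on the ancillas and
all qubits are measured in the computational basis. -/
noncomputable def born (U : Op (ι ⊕ α)) (ρ : Op ι) (z : ι ⊕ α → Fin 2) : ℂ :=
  ∑ x, ∑ y, U (withZeros x) z * star (U (withZeros y) z) * ρ y x

open Classical in
theorem trace_postEffect_mul (U : Op (ι ⊕ α)) (f : (ι ⊕ α → Fin 2) → Prop) (ρ : Op ι) :
    (postEffect U f * ρ).trace = ∑ z, if f z then born U ρ z else 0 := by
  simp only [Matrix.trace, Matrix.diag_apply, Matrix.mul_apply, postEffect, Matrix.of_apply,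
    Finset.sum_mul]
  have h1 : ∀ x : ι → Fin 2, (∑ y, ∑ z,
      (if f z then U (withZeros x) z * star (U (withZeros y) z) else 0) * ρ y x) =
      ∑ z, ∑ y, (if f z then U (withZeros x) z * star (U (withZeros y) z) else 0) * ρ y x :=
    fun x => Finset.sum_comm
  simp only [h1]
  rw [Finset.sum_comm]
  refine Finset.sum_congr rfl fun z _ => ?_
  split_ifs with hz
  · rfl
  · simp

/-- It is the quadratic form of `ρ` at the vector given by column `z` of `U` on zero ancillas. -/
theorem born_nonneg (U : Op (ι ⊕ α)) {ρ : Op ι} (hρ : ρ.PosSemidef) (z : ι ⊕ α → Fin 2) :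
    0 ≤ born U ρ z := by
  have h := hρ.dotProduct_mulVec_nonneg (fun x => U (withZeros x) z)
  convert h using 1
  simp only [born, dotProduct, Matrix.mulVec, Pi.star_apply, Finset.mul_sum]
  rw [Finset.sum_comm]
  refine Finset.sum_congr rfl fun y _ => Finset.sum_congr rfl fun x _ => ?_
  ring

theorem sum_born {U : Op (ι ⊕ α)} (hU : U * U.conjTranspose = 1) (ρ : Op ι) :
    ∑ z, born U ρ z = ρ.trace := by
  have h1 : ∀ x y : ι → Fin 2, ∑ z, U (withZeros x) z * star (U (withZeros y) z) =
      if x = y then 1 else 0 := by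
    intro x y
    have h := congrFun (congrFun hU (withZeros x)) (withZeros y)
    rw [Matrix.mul_apply] at h
    simp only [Matrix.conjTranspose_apply] at h
    rw [h, Matrix.one_apply]
    congr 1
    apply propext
    constructor
    · intro h'
      funext i
      exact congrFun h' (Sum.inl i)
    · rintro rfl; rfl
  have h2 : ∑ z, born U ρ z = ∑ x, ∑ y,
      (∑ z, U (withZeros x) z * star (U (withZeros y) z)) * ρ y x := by
    simp only [born, Finset.sum_mul]
    rw [Finset.sum_comm]
    refine Finset.sum_congr rfl fun x _ => ?_
    rw [Finset.sum_comm]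
  rw [h2]
  simp only [h1, ite_mul, one_mul, zero_mul, Finset.sum_ite_eq, Finset.mem_univ, if_true]
  rfl

theorem ofReal_prob_postEffect (U : Op (ι ⊕ α)) (f : (ι ⊕ α → Fin 2) → Prop) [DecidablePred f]
    {ρ : Op ι} (hρ : ρ.PosSemidef) :
    (prob (postEffect U f) ρ : ℂ) = ∑ z, if f z then born U ρ z else 0 := by
  have h1 : (postEffect U f * ρ).trace = ∑ z, if f z then born U ρ z else 0 := by
    rw [trace_postEffect_mul]
    exact Finset.sum_congr rfl fun z _ => by congr
  have h : 0 ≤ ∑ z, if f z then born U ρ z else 0 :=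
    Finset.sum_nonneg fun z _ => by split_ifs; exacts [born_nonneg U hρ z, le_rfl]
  rw [prob, h1]
  exact (Complex.eq_re_of_ofReal_le (by rw [Complex.ofReal_zero]; exact h)).symm

theorem prob_postEffect_nonneg (U : Op (ι ⊕ α)) (f : (ι ⊕ α → Fin 2) → Prop) {ρ : Op ι}
    (hρ : ρ.PosSemidef) : 0 ≤ prob (postEffect U f) ρ := by
  classical
  have h : 0 ≤ ∑ z, if f z then born U ρ z else 0 :=
    Finset.sum_nonneg fun z _ => by split_ifs; exacts [born_nonneg U hρ z, le_rfl]
  rw [← ofReal_prob_postEffect U f hρ] at h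
  exact_mod_cast h

theorem prob_postEffect_add_not {U : Op (ι ⊕ α)} (hU : U * U.conjTranspose = 1)
    (f : (ι ⊕ α → Fin 2) → Prop) {ρ : Op ι} (hρ : IsState ρ) :
    prob (postEffect U f) ρ + prob (postEffect U fun z => ¬ f z) ρ = 1 := by
  classical
  have h : ((prob (postEffect U f) ρ + prob (postEffect U fun z => ¬ f z) ρ : ℝ) : ℂ) = 1 := by
    rw [Complex.ofReal_add, ofReal_prob_postEffect U _ hρ.1, ofReal_prob_postEffect U _ hρ.1,
      ← Finset.sum_add_distrib, ← hρ.2, ← sum_born hU]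
    refine Finset.sum_congr rfl fun z _ => ?_
    by_cases hz : f z <;> simp [hz]
  exact_mod_cast h

theorem ketbra_apply (b x y : Fin 2) : ketbra b x y = if x = b ∧ y = b then 1 else 0 := by
  simp only [ketbra, Matrix.single_apply]
  congr 1
  apply propext
  tauto

open Classical in
theorem tensorOp_eq_diagonal {A : ι → Matrix (Fin 2) (Fin 2) ℂ}
    (hA : ∀ q, A q = ketbra 0 ∨ A q = ketbra 1 ∨ A q = 1) :
    tensorOp A = Matrix.diagonal fun z => if ∀ q, A q (z q) (z q) = 1 then 1 else 0 := by
  ext x y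
  rw [Matrix.diagonal_apply]
  simp only [tensorOp, Matrix.of_apply]
  split_ifs with hxy h
  · subst hxy
    exact Finset.prod_eq_one fun q _ => h q
  · subst hxy
    obtain ⟨q, hq⟩ := not_forall.1 h
    refine Finset.prod_eq_zero (Finset.mem_univ q) ?_
    rcases hA q with h | h | h
    · rw [h, ketbra_apply] at hq ⊢
      by_contra h0
      apply hq
      rw [if_pos]
      by_contra h1
      exact h0 (if_neg h1)
    · rw [h, ketbra_apply] at hq ⊢
      by_contra h0
      apply hq
      rw [if_pos]
      by_contra h1
      exact h0 (if_neg h1)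
    · rw [h] at hq; simp at hq
  · obtain ⟨q, hq⟩ := Function.ne_iff.1 hxy
    refine Finset.prod_eq_zero (Finset.mem_univ q) ?_
    rcases hA q with h | h | h
    · rw [h, ketbra_apply, if_neg]
      rintro ⟨h1, h2⟩
      exact hq (h1.trans h2.symm)
    · rw [h, ketbra_apply, if_neg]
      rintro ⟨h1, h2⟩
      exact hq (h1.trans h2.symm)
    · rw [h, Matrix.one_apply, if_neg hq]

theorem mul_diagonal_mul_conjTranspose_apply (U : Op ι) (d : (ι → Fin 2) → ℂ) (x y : ι → Fin 2) :
    (U * Matrix.diagonal d * U.conjTranspose) x y = ∑ z, d z * (U x z * star (U y z)) := by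
  rw [Matrix.mul_apply]
  refine Finset.sum_congr rfl fun z _ => ?_
  rw [Matrix.mul_diagonal, Matrix.conjTranspose_apply]
  ring

theorem ancZero_eq_postEffect {a : ℕ} (U : Op (ι ⊕ Fin a))
    {A : ι ⊕ Fin a → Matrix (Fin 2) (Fin 2) ℂ}
    (hA : ∀ q, A q = ketbra 0 ∨ A q = ketbra 1 ∨ A q = 1) :
    ancZero (U * tensorOp A * U.conjTranspose) =
      postEffect U fun z => ∀ q, A q (z q) (z q) = 1 := by
  classical
  ext x y
  rw [tensorOp_eq_diagonal hA]
  have h : ∀ X : Op (ι ⊕ Fin a), ancZero X x y = X (withZeros x) (withZeros y) := fun _ => rfl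
  rw [h, mul_diagonal_mul_conjTranspose_apply]
  simp only [postEffect, Matrix.of_apply, ite_mul, one_mul, zero_mul]
  exact Finset.sum_congr rfl fun z _ => by congr

/-- `|b⟩⟨b|` on the qubit `v`, the identity on the others. -/
def flag (v : ι) (b : Fin 2) (q : ι) : Matrix (Fin 2) (Fin 2) ℂ := if q = v then ketbra b else 1

theorem flag_cases (v : ι) (b : Fin 2) (q : ι) :
    flag v b q = ketbra 0 ∨ flag v b q = ketbra 1 ∨ flag v b q = 1 := by
  unfold flag
  split_ifs
  · fin_cases b <;> simp
  · simp

theorem forall_flag_iff (v : ι) (b : Fin 2) (z : ι → Fin 2) :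
    (∀ q, flag v b q (z q) (z q) = 1) ↔ z v = b := by
  constructor
  · intro h
    have := h v
    rw [flag, if_pos rfl, ketbra_apply] at this
    by_contra h'
    simp [h'] at this
  · rintro rfl q
    unfold flag
    split_ifs with h
    · subst h; simp [ketbra_apply]
    · simp

theorem sum_tensorOp_flag (v : ι) : tensorOp (flag v 0) + tensorOp (flag v 1) = 1 := by
  classical
  rw [tensorOp_eq_diagonal (flag_cases v 0), tensorOp_eq_diagonal (flag_cases v 1),
    Matrix.diagonal_add, ← Matrix.diagonal_one]
  congr 1
  funext z
  simp only [forall_flag_iff]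
  generalize z v = b
  fin_cases b <;> simp

/-- Postprocessing of the outcome with a classical circuit. -/
theorem exists_postEffect_eq {c d S : ℕ} {U : Op (ι ⊕ α)} (hU : HasCircuit c U)
    {g : (((ι ⊕ α) ⊕ Fin S) → Fin 2) → (((ι ⊕ α) ⊕ Fin S) → Fin 2)}
    (hg : HasCircuit d (permOp g)) (v : (ι ⊕ α) ⊕ Fin S) :
    ∃ (a : ℕ) (V : Op (ι ⊕ Fin a)) (v' : ι ⊕ Fin a), HasCircuit (c + d) V ∧
      ∀ b, postEffect V (fun z => z v' = b) = postEffect U fun z => g (withZeros z) v = b := by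
  classical
  set e : (ι ⊕ α) ⊕ Fin S ≃ ι ⊕ Fin (Fintype.card (α ⊕ Fin S)) :=
    (Equiv.sumAssoc ι α (Fin S)).trans (Equiv.sumCongr (Equiv.refl ι) (Fintype.equivFin _))
    with he
  set V₀ : Op ((ι ⊕ α) ⊕ Fin S) := liftOp Sum.inl U * permOp g with hV₀
  have hV₀c : HasCircuit (c + d) V₀ := (hU.lift Sum.inl_injective).mul hg
  refine ⟨_, liftOp e V₀, e v, hV₀c.lift e.injective, fun b => ?_⟩
  ext x y
  have hz : ∀ x : ι → Fin 2, (withZeros x) ∘ e =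
      (withZeros (withZeros x : ι ⊕ α → Fin 2) : (ι ⊕ α) ⊕ Fin S → Fin 2) := by
    intro x
    funext q
    rcases q with (q | q) | q <;> rfl
  -- Conjugation with the permutation pulls the projector back along `g`: reading `v` after the
  -- classical circuit is reading `g z v` before it.
  have hV₀' : V₀ * Matrix.diagonal (fun z : (ι ⊕ α) ⊕ Fin S → Fin 2 => if z v = b then 1 else 0) * V₀.conjTranspose =
      liftOp Sum.inl U * Matrix.diagonal (fun z => if g z v = b then 1 else 0) *
        (liftOp Sum.inl U).conjTranspose := by
    have hP : permOp g * Matrix.diagonal (fun z : (ι ⊕ α) ⊕ Fin S → Fin 2 => if z v = b then 1 else 0) *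
        (permOp g).conjTranspose = Matrix.diagonal (fun z : (ι ⊕ α) ⊕ Fin S → Fin 2 => if g z v = b then 1 else 0) := by
      ext x y
      rw [mul_diagonal_mul_conjTranspose_apply, Finset.sum_eq_single (g x), Matrix.diagonal_apply]
      · by_cases hxy : x = y
        · subst hxy; simp [permOp]
        · have : g y ≠ g x := fun h => hxy (hg.injective h).symm
          simp [permOp, hxy, this]
      · intro z _ hz
        simp [permOp, Ne.symm hz]
      · simp
    rw [hV₀, Matrix.conjTranspose_mul, ← hP]
    simp only [Matrix.mul_assoc]
  have h1 : postEffect (liftOp e V₀) (fun z => z (e v) = b) x y =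
      (V₀ * Matrix.diagonal (fun z : (ι ⊕ α) ⊕ Fin S → Fin 2 => if z v = b then 1 else 0) *
        V₀.conjTranspose : Op ((ι ⊕ α) ⊕ Fin S))
        (withZeros (withZeros x)) (withZeros (withZeros y)) := by
    rw [mul_diagonal_mul_conjTranspose_apply]
    simp only [postEffect, Matrix.of_apply, liftOp_equiv_apply, hz, ite_mul, one_mul, zero_mul]
    exact Fintype.sum_equiv (e.arrowCongr (Equiv.refl (Fin 2))).symm _ _ fun z => rfl
  rw [h1, hV₀', Matrix.mul_assoc, Matrix.mul_apply, sum_liftOp_mul Sum.inl_injective]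
  simp only [postEffect, Matrix.of_apply]
  refine Finset.sum_congr rfl fun z _ => ?_
  have hx : (withZeros (withZeros x : ι ⊕ α → Fin 2) : (ι ⊕ α) ⊕ Fin S → Fin 2) ∘ Sum.inl =
    withZeros x := rfl
  have hy : (withZeros (withZeros y : ι ⊕ α → Fin 2) : (ι ⊕ α) ⊕ Fin S → Fin 2) ∘ Sum.inl =
    withZeros y := rfl
  have hzz : Function.extend Sum.inl z (withZeros (withZeros x : ι ⊕ α → Fin 2)) =
      (withZeros z : (ι ⊕ α) ⊕ Fin S → Fin 2) := by
    funext q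
    rcases q with q | q
    · rw [Sum.inl_injective.extend_apply]; rfl
    · rw [Function.extend_apply' _ _ _ (by simp)]; rfl
  rw [hx, hzz, Matrix.diagonal_mul, Matrix.conjTranspose_apply, liftOp_apply_of_eq, hy]
  · have : (withZeros z : (ι ⊕ α) ⊕ Fin S → Fin 2) ∘ Sum.inl = z := rfl
    rw [this]
    split_ifs <;> simp
  · intro q hq
    rcases q with q | q
    · exact (hq ⟨q, rfl⟩).elim
    · rfl

/-- The threshold circuit leaves its verdict on one qubit. Projecting this qubit onto `|0⟩` gives
the accepting effect, and adding the projection onto `|1⟩` completes it to a measurement. -/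
theorem postEffect_threshold_mem {c : ℕ} {U : Op (ι ⊕ α)} (hU : HasCircuit c U)
    {J : Type} [Fintype J] (w : J → ι ⊕ α) (β : J → Fin 2) (T : ℕ) :
    let f : (ι ⊕ α → Fin 2) → Prop := fun z =>
      T ≤ (Finset.univ.filter fun j => z (w j) = β j).card
    postEffect U f ∈ effects ι (c + (10 * (Fintype.card J * T) + 1)) ∧
    ![postEffect U f, postEffect U fun z => ¬ f z] ∈
      measurements ι (c + (10 * (Fintype.card J * T) + 1)) 2 := by
  intro f
  obtain ⟨S, g, v, hg, hv⟩ := exists_threshold_circuit w β T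
  obtain ⟨a, V, v', hV, h⟩ := exists_postEffect_eq hU hg v
  have h0 : postEffect U f = ancZero (V * tensorOp (flag v' 0) * V.conjTranspose) := by
    rw [ancZero_eq_postEffect _ (flag_cases v' 0)]
    simp only [forall_flag_iff, h, hv]
    rfl
  have h1 : postEffect U (fun z => ¬ f z) =
      ancZero (V * tensorOp (flag v' 1) * V.conjTranspose) := by
    rw [ancZero_eq_postEffect _ (flag_cases v' 1)]
    simp only [forall_flag_iff, h]
    congr 1
    funext z
    apply propext
    change ¬ (T ≤ _) ↔ _
    rw [← hv]
    generalize g (withZeros z) v = b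
    fin_cases b <;> simp
  refine ⟨⟨a, V, flag v' 0, gateComplexity_le_iff.2 hV, fun q => ?_, h0⟩,
    a, V, ![flag v' 0, flag v' 1], gateComplexity_le_iff.2 hV, fun r q => ?_, ?_, fun r => ?_⟩
  · unfold flag; split_ifs <;> simp
  · fin_cases r
    · exact flag_cases v' 0 q
    · exact flag_cases v' 1 q
  · rw [Fin.sum_univ_two]
    exact sum_tensorOp_flag v'
  · fin_cases r
    · exact h0
    · exact h1

end Effects

end CompStein

namespace CompStein

/-! ### Tests versus two-outcome measurements, and independent repetition -/

section Measurements

variable {ι : Type} [Fintype ι] [DecidableEq ι]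

/-- An effect of complexity `G` is the first outcome of a two-outcome measurement: ancillas that
are not touched by the circuit are irrelevant, so that it suffices to compute the conjunction of
`|ι| + 2G` bits. -/
theorem exists_measurement_of_mem_effects {G : ℕ} {Λ : Op ι} (hΛ : Λ ∈ effects ι G) :
    ∃ M ∈ measurements ι (G + (10 * (Fintype.card ι + 2 * G) ^ 2 + 1)) 2, ∀ ρ, IsState ρ →
      prob (M 0) ρ = prob Λ ρ ∧ prob (M 1) ρ = 1 - prob Λ ρ ∧
      0 ≤ prob Λ ρ ∧ prob Λ ρ ≤ 1 := by
  classical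
  obtain ⟨a, U, A, hU, hA, rfl⟩ := hΛ
  rw [gateComplexity_le_iff] at hU
  obtain ⟨s, hs, hsU⟩ := hU.apply_eq
  -- Any other qubit is an ancilla outside the support of `U`. It is still zero, so the projection
  -- onto `|0⟩` imposes no condition there.
  set t : Finset (ι ⊕ Fin a) :=
    (Finset.univ.image Sum.inl ∪ s).filter fun q => A q = ketbra 0 with ht
  have htc : t.card ≤ Fintype.card ι + 2 * G :=
    (Finset.card_filter_le _ _).trans ((Finset.card_union_le _ _).trans
      (add_le_add Finset.card_image_le hs))
  have hA' : ∀ q, A q = ketbra 0 ∨ A q = ketbra 1 ∨ A q = 1 := fun q =>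
    (hA q).imp_right Or.inr
  -- A conjunction is the threshold function with the largest possible threshold.
  set f : (ι ⊕ Fin a → Fin 2) → Prop := fun z =>
      t.card ≤ (Finset.univ.filter fun j : t => z j = (fun _ => 0 : t → Fin 2) j).card with hf
  have hfz : ∀ z, f z ↔ ∀ q ∈ t, z q = 0 := by
    intro z
    have hc : t.card = (Finset.univ : Finset t).card := by simp
    constructor
    · intro h q hq
      have h2 := Finset.eq_of_subset_of_card_le (Finset.filter_subset _ _) (hc.symm.le.trans h)
      have h3 := Finset.mem_univ (⟨q, hq⟩ : t)
      rw [← h2] at h3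
      simpa using h3
    · intro h
      rw [hf]
      beta_reduce
      rw [Finset.filter_true_of_mem fun (j : t) _ => h j j.2, hc]
  have heq : ancZero (U * tensorOp A * U.conjTranspose) = postEffect U f := by
    rw [ancZero_eq_postEffect U hA']
    ext x y
    simp only [postEffect, Matrix.of_apply]
    refine Finset.sum_congr rfl fun z _ => ?_
    by_cases hz : U (withZeros x) z = 0
    · simp [hz]
    · congr 1
      apply propext
      rw [hfz]
      constructor
      · intro h q hq
        have := h q
        rw [(Finset.mem_filter.1 hq).2, ketbra_apply] at this
        by_contra h'
        simp [h'] at this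
      · intro h q
        rcases hA q with hq | hq
        · have hzq : z q = 0 := by
            by_cases hqt : q ∈ Finset.univ.image Sum.inl ∪ s
            · exact h q (Finset.mem_filter.2 ⟨hqt, hq⟩)
            · rw [Finset.mem_union, not_or] at hqt
              rw [← hsU _ _ hz q hqt.2]
              rcases q with q | q
              · exact (hqt.1 (Finset.mem_image_of_mem _ (Finset.mem_univ q))).elim
              · rfl
          rw [hq, hzq, ketbra_apply]; simp
        · rw [hq]; simp
  have hmem := (postEffect_threshold_mem hU (fun j : t => (j : ι ⊕ Fin a)) (fun _ => 0) t.card).2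
  have hle : G + (10 * (Fintype.card t * t.card) + 1) ≤
      G + (10 * (Fintype.card ι + 2 * G) ^ 2 + 1) := by
    rw [Fintype.card_coe, sq]
    gcongr
  obtain ⟨a', U', A'', hU', hrest⟩ := hmem
  refine ⟨_, ⟨a', U', A'', hU'.trans (by exact_mod_cast hle), hrest⟩, fun ρ hρ => ?_⟩
  have h1 := prob_postEffect_add_not hU.mul_conjTranspose f hρ
  have h2 := prob_postEffect_nonneg U f hρ.1
  have h3 := prob_postEffect_nonneg U (fun z => ¬ f z) hρ.1
  rw [heq]
  refine ⟨rfl, ?_, h2, by linarith⟩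
  exact eq_sub_of_add_eq' h1

/-- A two-outcome measurement reads out a single qubit. -/
theorem exists_flag_of_mem_measurements {G : ℕ} {M : Fin 2 → Op ι}
    (hM : M ∈ measurements ι G 2) :
    ∃ (a : ℕ) (U : Op (ι ⊕ Fin a)) (v : ι ⊕ Fin a) (c : Fin 2), HasCircuit G U ∧
      ∀ r, M r = postEffect U fun z => z v = c + r := by
  classical
  obtain ⟨a, U, A, hU, hA, hsum, hM⟩ := hM
  have hone : ∀ z : ι ⊕ Fin a → Fin 2, ((if ∀ q, A 0 q (z q) (z q) = 1 then 1 else 0 : ℂ) +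
      if ∀ q, A 1 q (z q) (z q) = 1 then 1 else 0) = 1 := by
    intro z
    rw [Fin.sum_univ_two, tensorOp_eq_diagonal (hA 0), tensorOp_eq_diagonal (hA 1),
      Matrix.diagonal_add] at hsum
    have := congrFun (congrFun hsum z) z
    rw [Matrix.diagonal_apply_eq, Matrix.one_apply_eq] at this
    convert this
  -- If every qubit had a value compatible with both outcomes, these values would form a string
  -- counted twice in the resolution of the identity.
  obtain ⟨v, hv⟩ : ∃ v, ∀ b, ¬ (A 0 v b b = 1 ∧ A 1 v b b = 1) := by
    by_contra! h
    choose z hz using h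
    have := hone z
    rw [if_pos fun q => (hz q).1, if_pos fun q => (hz q).2] at this
    norm_num at this
  obtain ⟨c, hc⟩ : ∃ c : Fin 2, ∀ r, A r v = ketbra (c + r) := by
    rcases hA 0 v with h0 | h0 | h0 <;> rcases hA 1 v with h1 | h1 | h1
    · exact (hv 0 (by simp [h0, h1, ketbra_apply])).elim
    · refine ⟨0, fun r => ?_⟩
      fin_cases r
      · exact h0
      · exact h1
    · exact (hv 0 (by simp [h0, h1, ketbra_apply])).elim
    · refine ⟨1, fun r => ?_⟩
      fin_cases r
      · exact h0
      · exact h1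
    · exact (hv 1 (by simp [h0, h1, ketbra_apply])).elim
    · exact (hv 1 (by simp [h0, h1, ketbra_apply])).elim
    · exact (hv 0 (by simp [h0, h1, ketbra_apply])).elim
    · exact (hv 1 (by simp [h0, h1, ketbra_apply])).elim
    · exact (hv 0 (by simp [h0, h1])).elim
  have himp : ∀ (r : Fin 2) (z : ι ⊕ Fin a → Fin 2), (∀ q, A r q (z q) (z q) = 1) → z v = c + r := by
    intro r z h
    have := h v
    rw [hc, ketbra_apply] at this
    by_contra h'
    simp [h'] at this
  refine ⟨a, U, v, c, gateComplexity_le_iff.1 hU, fun r => ?_⟩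
  rw [hM r, ancZero_eq_postEffect U (hA r)]
  congr 1
  funext z
  apply propext
  refine ⟨himp r z, fun h => ?_⟩
  -- The string must belong to one of the two outcomes. If it is not `r`, it is the other one, which
  -- forces the opposite value at `v`.
  by_contra hr
  have h1 := hone z
  fin_cases r
  · change ¬ ∀ q, A 0 q (z q) (z q) = 1 at hr
    rw [if_neg hr, zero_add] at h1
    have h2 : ∀ q, A 1 q (z q) (z q) = 1 := by
      by_contra h2
      rw [if_neg h2] at h1
      norm_num at h1
    have h3 := himp 1 z h2
    rw [h] at h3
    exact absurd (add_left_cancel h3) (by decide)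
  · change ¬ ∀ q, A 1 q (z q) (z q) = 1 at hr
    rw [if_neg hr, add_zero] at h1
    have h2 : ∀ q, A 0 q (z q) (z q) = 1 := by
      by_contra h2
      rw [if_neg h2] at h1
      norm_num at h1
    have h3 := himp 0 z h2
    rw [h] at h3
    exact absurd (add_left_cancel h3) (by decide)

theorem prob_nonneg_of_mem_measurements {G : ℕ} {M : Fin 2 → Op ι}
    (hM : M ∈ measurements ι G 2) {ρ : Op ι} (hρ : IsState ρ) (r : Fin 2) : 0 ≤ prob (M r) ρ := by
  obtain ⟨a, U, v, c, hU, h⟩ := exists_flag_of_mem_measurements hM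
  rw [h]
  exact prob_postEffect_nonneg U _ hρ.1

theorem prob_add_of_mem_measurements {G : ℕ} {M : Fin 2 → Op ι}
    (hM : M ∈ measurements ι G 2) {ρ : Op ι} (hρ : IsState ρ) :
    prob (M 0) ρ + prob (M 1) ρ = 1 := by
  obtain ⟨a, U, v, c, hU, h⟩ := exists_flag_of_mem_measurements hM
  rw [h, h, ← prob_postEffect_add_not hU.mul_conjTranspose (fun z => z v = c + 0) hρ]
  congr 3
  funext z
  apply propext
  generalize z v = b
  clear h
  revert b c; decide

theorem sum_prod_curry {m : ℕ} {κ : Type} [Fintype κ] [DecidableEq κ]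
    (F : Fin m → (κ → Fin 2) → ℂ) :
    ∑ z : Fin m × κ → Fin 2, ∏ i, F i (fun k => z (i, k)) = ∏ i, ∑ z, F i z := by
  rw [Finset.prod_univ_sum, Fintype.piFinset_univ]
  exact Fintype.sum_equiv (Equiv.curry (Fin m) κ (Fin 2)) _ _ fun z => rfl

theorem tensorPow_mul (A B : Op ι) (m : ℕ) :
    tensorPow (A * B) m = tensorPow A m * tensorPow B m := by
  ext x y
  simp only [tensorPow, Matrix.mul_apply, Matrix.of_apply]
  rw [← sum_prod_curry (m := m) fun j z => A (fun i => x (j, i)) z * B z fun i => y (j, i)]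
  exact Finset.sum_congr rfl fun z _ => Finset.prod_mul_distrib

open scoped MatrixOrder Matrix.Norms.L2Operator in
theorem isState_tensorPow {ρ : Op ι} (hρ : IsState ρ) (m : ℕ) : IsState (tensorPow ρ m) := by
  constructor
  -- Positivity is inherited through a factorisation `B† B`, since tensor powers are multiplicative.
  · obtain ⟨B, hB⟩ := CStarAlgebra.nonneg_iff_eq_star_mul_self.mp hρ.1.nonneg
    rw [Matrix.star_eq_conjTranspose] at hB
    have : tensorPow ρ m = (tensorPow B m).conjTranspose * tensorPow B m := by
      rw [hB, tensorPow_mul]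
      congr 1
      ext x y
      simp [tensorPow, Matrix.conjTranspose_apply]
    rw [this]
    exact Matrix.posSemidef_conjTranspose_mul_self _
  · simp only [Matrix.trace, Matrix.diag_apply, tensorPow, Matrix.of_apply]
    rw [sum_prod_curry (m := m) fun _ z => ρ z z]
    exact Finset.prod_eq_one fun _ _ => hρ.2

theorem born_tensorPow {a m : ℕ} (U : Op (ι ⊕ Fin a)) (ρ : Op ι)
    (z : (Fin m × ι) ⊕ (Fin m × Fin a) → Fin 2) :
    born (liftOp (Equiv.prodSumDistrib (Fin m) ι (Fin a)) (tensorPow U m)) (tensorPow ρ m) z =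
      ∏ i, born U ρ fun k => z (Equiv.prodSumDistrib (Fin m) ι (Fin a) (i, k)) := by
  simp only [born]
  rw [← sum_prod_curry (m := m)]
  refine Finset.sum_congr rfl fun x _ => ?_
  rw [← sum_prod_curry (m := m)]
  refine Finset.sum_congr rfl fun y _ => ?_
  have h : ∀ (x : Fin m × ι → Fin 2) (i : Fin m), (fun k => ((withZeros x :
      (Fin m × ι) ⊕ (Fin m × Fin a) → Fin 2) ∘ (Equiv.prodSumDistrib (Fin m) ι (Fin a))) (i, k)) =
      withZeros fun k => x (i, k) := by
    intro x i
    funext k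
    rcases k with k | k <;> rfl
  rw [liftOp_equiv_apply, liftOp_equiv_apply]
  simp only [tensorPow, Matrix.of_apply, h, star_prod, ← Finset.prod_mul_distrib]
  rfl

/-- On a product state the outcomes of the copies are independent (`born_tensorPow`), so counting
the outcome `b` with the threshold circuit gives a binomial tail probability. -/
theorem exists_iterated_measurement {G : ℕ} {M : Fin 2 → Op ι} (hM : M ∈ measurements ι G 2)
    (m T : ℕ) (b : Fin 2) :
    ∃ M' : Fin 2 → Op (Fin m × ι), M' ∈ measurements (Fin m × ι) (m * G + (10 * (m * T) + 1)) 2 ∧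
      M' 0 ∈ effects (Fin m × ι) (m * G + (10 * (m * T) + 1)) ∧
      ∀ ρ, IsState ρ → prob (M' 0) (tensorPow ρ m) = ∑ r : Fin m → Fin 2,
        if T ≤ (Finset.univ.filter fun i => r i = b).card then ∏ i, prob (M (r i)) ρ else 0 := by
  classical
  obtain ⟨a, U, v, c, hU, h⟩ := exists_flag_of_mem_measurements hM
  set e := Equiv.prodSumDistrib (Fin m) ι (Fin a) with he
  have hV := (hU.tensorPow m).lift e.injective
  have hmem := postEffect_threshold_mem hV (fun i => e (i, v)) (fun _ => c + b) T
  rw [Fintype.card_fin] at hmem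
  refine ⟨_, hmem.2, hmem.1, fun ρ hρ => ?_⟩
  rw [Matrix.cons_val_zero]
  apply Complex.ofReal_injective
  rw [ofReal_prob_postEffect _ _ (isState_tensorPow hρ m).1]
  simp only [he, born_tensorPow]
  simp only [Complex.ofReal_sum, apply_ite Complex.ofReal, Complex.ofReal_prod, Complex.ofReal_zero, h,
    ofReal_prob_postEffect U _ hρ.1]
  have h1 : ∀ r : Fin m → Fin 2, (∏ i, ∑ z, if z v = c + r i then born U ρ z else 0) =
      ∑ z : Fin m × (ι ⊕ Fin a) → Fin 2, ∏ i,
        if z (i, v) = c + r i then born U ρ (fun k => z (i, k)) else 0 := fun r =>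
    (sum_prod_curry fun i z => if z v = c + r i then born U ρ z else 0).symm
  simp only [h1]
  have h2 : ∀ r : Fin m → Fin 2, (if T ≤ (Finset.univ.filter fun i => r i = b).card then
      ∑ z : Fin m × (ι ⊕ Fin a) → Fin 2, ∏ i,
        if z (i, v) = c + r i then born U ρ (fun k => z (i, k)) else 0 else 0) =
      ∑ z : Fin m × (ι ⊕ Fin a) → Fin 2,
      (if T ≤ (Finset.univ.filter fun i => r i = b).card then ∏ i,
        if z (i, v) = c + r i then born U ρ (fun k => z (i, k)) else 0 else 0) := by
    intro r
    split_ifs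
    · rfl
    · simp
  simp only [h2]
  rw [Finset.sum_comm]
  refine Fintype.sum_equiv (e.arrowCongr (Equiv.refl (Fin 2))).symm _ _ fun z => ?_
  have hsub : ∀ x y : Fin 2, x = c + y ↔ y = x - c := by
    intro x y
    rw [eq_sub_iff_add_eq, add_comm, eq_comm]
  -- A measured string determines the outcome of each copy, so after the exchange of sums only this
  -- outcome sequence contributes.
  set r₀ : Fin m → Fin 2 := fun i => z (e (i, v)) - c with hr₀
  rw [Finset.sum_eq_single r₀]
  · have h3 : ∀ i, z (e (i, v)) = c + r₀ i := fun i => (hsub _ _).2 rfl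
    have h4 : ∀ i, (z (e (i, v)) = c + b) ↔ r₀ i = b := fun i => by
      rw [h3]; exact add_right_inj c
    change (if T ≤ (Finset.univ.filter fun i => z (e (i, v)) = c + b).card then _ else _) =
      if T ≤ _ then ∏ i, (if z (e (i, v)) = c + r₀ i then born U ρ (fun k => z (e (i, k))) else 0)
        else 0
    simp only [← h3, if_true, h4]
    rfl
  · intro r _ hr
    obtain ⟨i, hi⟩ := Function.ne_iff.1 hr
    split_ifs
    · refine Finset.prod_eq_zero (Finset.mem_univ i) (if_neg ?_)
      intro h'
      exact hi ((hsub _ _).1 h')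
    · rfl
  · simp

end Measurements

/-! ### Relabelling of qubits and grouping of copies into blocks -/

section Relabel

variable {ι ι' : Type} [Fintype ι] [DecidableEq ι] [Fintype ι'] [DecidableEq ι']

theorem liftOp_tensorOp (e : ι ≃ ι') (A : ι → Matrix (Fin 2) (Fin 2) ℂ) :
    liftOp e (tensorOp A) = tensorOp fun q => A (e.symm q) := by
  ext x y
  rw [liftOp_equiv_apply]
  exact Fintype.prod_equiv e _ _ fun q => by simp

theorem liftOp_ancZero {a : ℕ} (e : ι ≃ ι') (X : Op (ι ⊕ Fin a)) :
    liftOp e (ancZero X) = ancZero (liftOp (Equiv.sumCongr e (Equiv.refl (Fin a))) X) := by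
  ext x y
  rw [liftOp_equiv_apply]
  simp only [ancZero, Matrix.of_apply]
  rw [liftOp_equiv_apply]
  congr 1 <;> funext q <;> rcases q with q | q <;> rfl

theorem liftOp_ancZero_conj {a : ℕ} (e : ι ≃ ι') (U : Op (ι ⊕ Fin a))
    (A : ι ⊕ Fin a → Matrix (Fin 2) (Fin 2) ℂ) :
    liftOp e (ancZero (U * tensorOp A * U.conjTranspose)) =
      ancZero (liftOp (Equiv.sumCongr e (Equiv.refl (Fin a))) U *
        tensorOp (fun q => A ((Equiv.sumCongr e (Equiv.refl (Fin a))).symm q)) *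
        (liftOp (Equiv.sumCongr e (Equiv.refl (Fin a))) U).conjTranspose) := by
  rw [liftOp_ancZero, liftOp_conjTranspose, ← liftOp_tensorOp, liftOp_mul (Equiv.injective _),
    liftOp_mul (Equiv.injective _)]

theorem liftOp_mem_effects (e : ι ≃ ι') {G : ℕ} {Λ : Op ι} (hΛ : Λ ∈ effects ι G) :
    liftOp e Λ ∈ effects ι' G := by
  obtain ⟨a, U, A, hU, hA, rfl⟩ := hΛ
  exact ⟨a, _, _, gateComplexity_le_iff.2 ((gateComplexity_le_iff.1 hU).lift (Equiv.injective _)),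
    fun i => hA _, liftOp_ancZero_conj e U A⟩

theorem liftOp_mem_measurements (e : ι ≃ ι') {G K : ℕ} {M : Fin K → Op ι}
    (hM : M ∈ measurements ι G K) : (fun r => liftOp e (M r)) ∈ measurements ι' G K := by
  obtain ⟨a, U, A, hU, hA, hsum, hM⟩ := hM
  refine ⟨a, liftOp (Equiv.sumCongr e (Equiv.refl (Fin a))) U, fun r q => A r ((Equiv.sumCongr e (Equiv.refl (Fin a))).symm q),
    gateComplexity_le_iff.2 ((gateComplexity_le_iff.1 hU).lift (Equiv.injective _)),
    fun r i => hA _ _, ?_, fun r => ?_⟩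
  · rw [← liftOp_one (Equiv.sumCongr e (Equiv.refl (Fin a))), ← hsum]
    ext x y
    simp only [← liftOp_tensorOp, Matrix.sum_apply, liftOp_equiv_apply]
  · beta_reduce
    rw [hM, liftOp_ancZero_conj]

theorem prob_liftOp (e : ι ≃ ι') (Λ ρ : Op ι) : prob (liftOp e Λ) (liftOp e ρ) = prob Λ ρ := by
  rw [prob, prob, liftOp_mul e.injective]
  congr 1
  exact Fintype.sum_equiv (e.arrowCongr (Equiv.refl (Fin 2))).symm _ _ fun z =>
    liftOp_equiv_apply e _ z z

/-- The labels of `m` blocks of `s` copies, as labels of `m s` copies. -/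
def blockEquiv (m s : ℕ) (ι : Type) : Fin m × (Fin s × ι) ≃ Fin (m * s) × ι :=
  (Equiv.prodAssoc _ _ _).symm.trans (Equiv.prodCongr finProdFinEquiv (Equiv.refl ι))

theorem liftOp_tensorPow_tensorPow (ρ : Op ι) (m s : ℕ) :
    liftOp (blockEquiv m s ι) (tensorPow (tensorPow ρ s) m) = tensorPow ρ (m * s) := by
  ext x y
  rw [liftOp_equiv_apply]
  simp only [tensorPow, Matrix.of_apply]
  rw [← Fintype.prod_prod_type']
  exact Fintype.prod_equiv finProdFinEquiv _ _ fun p => rfl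

theorem exists_block_measurement {s G : ℕ} {M : Fin 2 → Op (Fin s × ι)}
    (hM : M ∈ measurements (Fin s × ι) G 2) (m T : ℕ) (b : Fin 2) :
    ∃ M' : Fin 2 → Op (Fin (m * s) × ι),
      M' ∈ measurements (Fin (m * s) × ι) (m * G + (10 * (m * T) + 1)) 2 ∧
      M' 0 ∈ effects (Fin (m * s) × ι) (m * G + (10 * (m * T) + 1)) ∧
      ∀ ρ, IsState ρ → prob (M' 0) (tensorPow ρ (m * s)) = ∑ r : Fin m → Fin 2,
        if T ≤ (Finset.univ.filter fun i => r i = b).card then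
          ∏ i, prob (M (r i)) (tensorPow ρ s) else 0 := by
  obtain ⟨M', h1, h2, h3⟩ := exists_iterated_measurement hM m T b
  refine ⟨_, liftOp_mem_measurements (blockEquiv m s ι) h1, liftOp_mem_effects _ h2,
    fun ρ hρ => ?_⟩
  rw [← h3 _ (isState_tensorPow hρ s), ← liftOp_tensorPow_tensorPow, prob_liftOp]

theorem effects_mono {G G' : ℕ} (h : G ≤ G') : effects ι G ⊆ effects ι G' := by
  rintro _ ⟨a, U, A, hU, hA, rfl⟩
  exact ⟨a, U, A, hU.trans (by exact_mod_cast h), hA, rfl⟩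

theorem measurements_mono {G G' K : ℕ} (h : G ≤ G') : measurements ι G K ⊆ measurements ι G' K := by
  rintro M ⟨a, U, A, hU, hA, hM⟩
  exact ⟨a, U, A, hU.trans (by exact_mod_cast h), hA, hM⟩

end Relabel

end CompStein

namespace CompStein

/-! ### Classical hypothesis testing with two outcomes -/

section Stein

theorem sum_fin_succ_fun {m : ℕ} (F : (Fin (m + 1) → Fin 2) → ℝ) :
    ∑ r, F r = ∑ a : Fin 2, ∑ r : Fin m → Fin 2, F (Fin.cons a r) := by
  rw [← Fintype.sum_prod_type']
  exact (Fintype.sum_equiv (Fin.consEquiv fun _ => Fin 2) _ _ fun p => rfl).symm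

theorem sum_prod_eq_one {p : Fin 2 → ℝ} (hp : ∑ a, p a = 1) (m : ℕ) :
    ∑ r : Fin m → Fin 2, ∏ i, p (r i) = 1 := by
  have h := Finset.prod_univ_sum (fun _ : Fin m => (Finset.univ : Finset (Fin 2))) fun _ a => p a
  rw [Fintype.piFinset_univ] at h
  rw [← h]
  exact Finset.prod_eq_one fun _ _ => hp

theorem sum_prod_mul_sum {p y : Fin 2 → ℝ} (hp : ∑ a, p a = 1) (hy : ∑ a, p a * y a = 0) (m : ℕ) :
    ∑ r : Fin m → Fin 2, (∏ i, p (r i)) * ∑ i, y (r i) = 0 := by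
  induction m with
  | zero => simp
  | succ m ih =>
    rw [sum_fin_succ_fun]
    have h : ∀ a : Fin 2, ∑ r : Fin m → Fin 2, (∏ i, p ((Fin.cons a r : Fin (m + 1) → Fin 2) i)) *
        ∑ i, y ((Fin.cons a r : Fin (m + 1) → Fin 2) i) = p a * y a := by
      intro a
      simp only [Fin.prod_univ_succ, Fin.sum_univ_succ, Fin.cons_zero, Fin.cons_succ]
      have : ∀ r : Fin m → Fin 2, p a * (∏ i, p (r i)) * (y a + ∑ i, y (r i)) =
          p a * y a * (∏ i, p (r i)) + p a * ((∏ i, p (r i)) * ∑ i, y (r i)) := fun r => by ring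
      simp only [this]
      rw [Finset.sum_add_distrib, ← Finset.mul_sum, ← Finset.mul_sum, ih, sum_prod_eq_one hp]
      ring
    simp only [h, hy]

theorem sum_prod_mul_sum_sq {p y : Fin 2 → ℝ} (hp : ∑ a, p a = 1) (hy : ∑ a, p a * y a = 0)
    (m : ℕ) :
    ∑ r : Fin m → Fin 2, (∏ i, p (r i)) * (∑ i, y (r i)) ^ 2 = m * ∑ a, p a * y a ^ 2 := by
  induction m with
  | zero => simp
  | succ m ih =>
    rw [sum_fin_succ_fun]
    set V := ∑ a, p a * y a ^ 2 with hV
    have h : ∀ a : Fin 2, ∑ r : Fin m → Fin 2, (∏ i, p ((Fin.cons a r : Fin (m + 1) → Fin 2) i)) *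
        (∑ i, y ((Fin.cons a r : Fin (m + 1) → Fin 2) i)) ^ 2 =
        p a * y a ^ 2 + p a * (m * V) := by
      intro a
      simp only [Fin.prod_univ_succ, Fin.sum_univ_succ, Fin.cons_zero, Fin.cons_succ]
      have : ∀ r : Fin m → Fin 2, p a * (∏ i, p (r i)) * (y a + ∑ i, y (r i)) ^ 2 =
          p a * y a ^ 2 * (∏ i, p (r i)) + 2 * p a * y a * ((∏ i, p (r i)) * ∑ i, y (r i)) +
            p a * ((∏ i, p (r i)) * (∑ i, y (r i)) ^ 2) := fun r => by ring
      simp only [this]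
      rw [Finset.sum_add_distrib, Finset.sum_add_distrib, ← Finset.mul_sum, ← Finset.mul_sum,
        ← Finset.mul_sum, ih, sum_prod_eq_one hp, sum_prod_mul_sum hp hy]
      ring
    simp only [h]
    rw [Finset.sum_add_distrib, ← Finset.sum_mul, hp, ← hV]
    push_cast
    ring

/-- Chebyshev's inequality for independent trials with two outcomes. -/
theorem sum_prod_lt_le {p y : Fin 2 → ℝ} (hp0 : ∀ a, 0 ≤ p a) (hp : ∑ a, p a = 1)
    {m : ℕ} (hm : 0 < m) {δ : ℝ} (hδ : 0 < δ) :
    (∑ r : Fin m → Fin 2, if ∑ i, y (r i) < m * ((∑ a, p a * y a) - δ) then ∏ i, p (r i) else 0) ≤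
      (∑ a, p a * y a ^ 2) / (m * δ ^ 2) := by
  set D := ∑ a, p a * y a with hD
  set y' : Fin 2 → ℝ := fun a => y a - D with hy'
  have hm' : (0 : ℝ) < m := by exact_mod_cast hm
  have hp2 : p 0 + p 1 = 1 := by rw [← hp, Fin.sum_univ_two]
  have hy0 : ∑ a, p a * y' a = 0 := by
    simp only [hy', mul_sub, Finset.sum_sub_distrib, ← Finset.sum_mul, hp]
    rw [← hD]; ring
  have hvar : ∑ a, p a * y' a ^ 2 ≤ ∑ a, p a * y a ^ 2 := by
    have : ∑ a, p a * y' a ^ 2 = (∑ a, p a * y a ^ 2) - D ^ 2 := by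
      have e : ∀ a, p a * y' a ^ 2 = p a * y a ^ 2 - 2 * D * (p a * y a) + p a * D ^ 2 :=
        fun a => by rw [hy']; ring
      simp only [e]
      rw [Finset.sum_add_distrib, Finset.sum_sub_distrib, ← Finset.mul_sum, ← Finset.sum_mul, hp,
        ← hD]
      ring
    rw [this]
    nlinarith [sq_nonneg D]
  have key : ∀ r : Fin m → Fin 2, (if ∑ i, y (r i) < m * (D - δ) then ∏ i, p (r i) else 0) ≤
      ((∏ i, p (r i)) * (∑ i, y' (r i)) ^ 2) / (m * δ) ^ 2 := by
    intro r
    have hP : 0 ≤ ∏ i, p (r i) := Finset.prod_nonneg fun i _ => hp0 _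
    split_ifs with h
    · rw [le_div_iff₀ (by positivity)]
      apply mul_le_mul_of_nonneg_left _ hP
      have : ∑ i, y' (r i) = (∑ i, y (r i)) - m * D := by
        simp [hy', Finset.sum_sub_distrib]
      rw [this]
      have h2 : m * δ < m * D - ∑ i, y (r i) := by linarith
      nlinarith [mul_pos hm' hδ]
    · positivity
  calc _ ≤ ∑ r : Fin m → Fin 2, ((∏ i, p (r i)) * (∑ i, y' (r i)) ^ 2) / (m * δ) ^ 2 :=
        Finset.sum_le_sum fun r _ => key r
    _ = (m * ∑ a, p a * y' a ^ 2) / (m * δ) ^ 2 := by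
        rw [← Finset.sum_div, sum_prod_mul_sum_sq hp hy0]
    _ ≤ (m * ∑ a, p a * y a ^ 2) / (m * δ) ^ 2 := by gcongr
    _ = _ := by field_simp

/-- The max-relative entropy bounds the logarithm only from above. Negative values are harmless for
the second moment: `log x ≤ 2 √x` at `x = q / p` bounds their contribution by `4q`. -/
theorem mul_log_div_sq_le {p q L : ℝ} (hp : 0 < p) (hq : 0 < q)
    (h : p ≤ Real.exp L * q) : p * Real.log (p / q) ^ 2 ≤ p * L ^ 2 + 4 * q := by
  have hle : Real.log (p / q) ≤ L := by
    rw [Real.log_le_iff_le_exp (by positivity), div_le_iff₀ hq]; exact h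
  rcases le_or_gt 0 (Real.log (p / q)) with h0 | h0
  · have : Real.log (p / q) ^ 2 ≤ L ^ 2 := by gcongr
    nlinarith
  · have h1 : Real.log (q / p) ≤ (q / p) ^ (1 / 2 : ℝ) / (1 / 2) :=
      Real.log_le_rpow_div (by positivity) (by norm_num)
    have h2 : Real.log (q / p) = - Real.log (p / q) := by
      rw [← Real.log_inv, inv_div]
    rw [← Real.sqrt_eq_rpow, h2] at h1
    have h3 : Real.log (p / q) ^ 2 ≤ 4 * (q / p) := by
      have h4 : Real.sqrt (q / p) ^ 2 = q / p := Real.sq_sqrt (by positivity)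
      have h5 := Real.sqrt_nonneg (q / p)
      nlinarith
    calc p * Real.log (p / q) ^ 2 ≤ p * (4 * (q / p)) := by gcongr
      _ = 4 * q := by field_simp
      _ ≤ _ := by nlinarith [mul_nonneg hp.le (sq_nonneg L)]

/-- The number of trials with outcome `b`. -/
def countEq {m : ℕ} (b : Fin 2) (r : Fin m → Fin 2) : ℕ :=
  (Finset.univ.filter fun i => r i = b).card

theorem sum_apply_eq_countEq {m : ℕ} (b : Fin 2) (y : Fin 2 → ℝ) (r : Fin m → Fin 2) :
    ∑ i, y (r i) = countEq b r * y b + (m - countEq b r) * y (b + 1) := by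
  have h : ∀ i, y (r i) = (if r i = b then y b else 0) + (y (b + 1) -
      (if r i = b then y (b + 1) else 0)) := by
    intro i
    by_cases hi : r i = b
    · simp [hi]
    · have : r i = b + 1 := by
        revert hi
        generalize r i = c
        revert b c; decide
      rw [if_neg hi, if_neg hi, this]; ring
  simp only [h]
  rw [Finset.sum_add_distrib, Finset.sum_sub_distrib, ← Finset.sum_filter, ← Finset.sum_filter]
  simp only [Finset.sum_const, Finset.card_univ, Fintype.card_fin, nsmul_eq_mul]
  rw [countEq]
  ring

theorem le_countEq_self_iff {m : ℕ} (b : Fin 2) (r : Fin m → Fin 2) :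
    m ≤ countEq b r ↔ r = fun _ => b := by
  constructor
  · intro h
    have h2 := Finset.eq_of_subset_of_card_le
      (Finset.filter_subset (fun i => r i = b) (Finset.univ : Finset (Fin m)))
      (by simpa [countEq] using h)
    funext i
    have := Finset.mem_univ i
    rw [← h2] at this
    simpa using this
  · rintro rfl
    simp [countEq]

theorem sum_le_countEq_self {m : ℕ} (b : Fin 2) (p : Fin 2 → ℝ) :
    (∑ r : Fin m → Fin 2, if m ≤ countEq b r then ∏ i, p (r i) else 0) = p b ^ m := by
  simp only [le_countEq_self_iff]
  rw [Finset.sum_ite_eq']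
  simp

/-- Achievability in Stein's lemma for two-outcome distributions, with a test that compares the
number of trials with a given outcome with a threshold. -/
theorem exists_threshold_test {p q : Fin 2 → ℝ} (hp0 : ∀ a, 0 ≤ p a) (hp : ∑ a, p a = 1)
    (hq0 : ∀ a, 0 ≤ q a) (hq : ∑ a, q a = 1) {L : ℝ}
    (hpq : ∀ a, p a ≤ Real.exp L * q a) {m : ℕ} (hm : 0 < m) {δ ε : ℝ} (hδ : 0 < δ)
    (hε : (L ^ 2 + 4) / (m * δ ^ 2) ≤ ε) :
    ∃ (b : Fin 2) (T : ℕ), T ≤ m ∧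
      1 - ε ≤ (∑ r : Fin m → Fin 2, if T ≤ countEq b r then ∏ i, p (r i) else 0) ∧
      (∑ r : Fin m → Fin 2, if T ≤ countEq b r then ∏ i, q (r i) else 0) ≤
        Real.exp (-(m * ((∑ a, p a * Real.log (p a / q a)) - δ))) := by
  have hm' : (0 : ℝ) < m := by exact_mod_cast hm
  have hε0 : 0 ≤ ε := le_trans (by positivity) hε
  have hqpos : ∀ a, 0 < p a → 0 < q a := by
    intro a ha
    have h := hpq a
    by_contra h'
    have : q a = 0 := le_antisymm (not_lt.1 h') (hq0 a)
    rw [this, mul_zero] at h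
    linarith
  have hsum2 : ∀ (y : Fin 2 → ℝ) (b : Fin 2), ∑ a, y a = y b + y (b + 1) := by
    intro y b
    rw [Fin.sum_univ_two]
    fin_cases b
    · rfl
    · exact add_comm _ _
  -- If `p` is concentrated on `b`, accepting only constant sequences `b` has no type I error, and
  -- its type II error is exactly `exp (-m D)`.
  by_cases hdeg : ∃ b : Fin 2, p (b + 1) = 0
  · obtain ⟨b, hb⟩ := hdeg
    have hpb : p b = 1 := by rw [hsum2 p b, hb, add_zero] at hp; exact hp
    have hqb := hqpos b (by rw [hpb]; norm_num)
    refine ⟨b, m, le_rfl, ?_, ?_⟩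
    · rw [sum_le_countEq_self, hpb, one_pow]; linarith
    · rw [sum_le_countEq_self, hsum2 _ b, hpb, hb, one_mul, zero_mul, add_zero, one_div,
        Real.log_inv]
      have : q b ^ m = Real.exp (m * Real.log (q b)) := by
        rw [mul_comm, Real.exp_mul, Real.exp_log hqb, Real.rpow_natCast]
      rw [this, Real.exp_le_exp]
      nlinarith
  · have hppos : ∀ a, 0 < p a := by
      intro a
      refine lt_of_le_of_ne (hp0 a) fun h => hdeg ⟨a + 1, ?_⟩
      have : a + 1 + 1 = a := by clear h; revert a; decide
      rw [this, h]
    have hqpos' : ∀ a, 0 < q a := fun a => hqpos a (hppos a)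
    set y : Fin 2 → ℝ := fun a => Real.log (p a / q a) with hy
    set D := ∑ a, p a * y a with hD
    -- For the outcome with the larger log-likelihood ratio, the total log-likelihood ratio is
    -- nondecreasing in the count, so the likelihood-ratio test becomes a threshold test. The full
    -- count `m` passes it because `D ≤ y b`, so a least threshold exists.
    obtain ⟨b, hb⟩ : ∃ b : Fin 2, y (b + 1) ≤ y b := by
      rcases le_total (y 0) (y 1) with h | h
      · exact ⟨1, h⟩
      · exact ⟨0, h⟩
    have hDb : D ≤ y b := by
      rw [hD, hsum2 _ b]
      have h1 : p b + p (b + 1) = 1 := by rw [← hsum2 p b]; exact hp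
      have h2 : y b = p b * y b + p (b + 1) * y b := by rw [← add_mul, h1, one_mul]
      have h3 := mul_le_mul_of_nonneg_left hb (hppos (b + 1)).le
      linarith
    have hex : ∃ c : ℕ, m * (D - δ) ≤ c * y b + (m - c) * y (b + 1) :=
      ⟨m, by rw [sub_self, zero_mul, add_zero]; nlinarith⟩
    classical
    have hiff : ∀ r : Fin m → Fin 2, Nat.find hex ≤ countEq b r ↔
        m * (D - δ) ≤ ∑ i, y (r i) := by
      intro r
      rw [sum_apply_eq_countEq b]
      constructor
      · intro h
        have h1 := Nat.find_spec hex
        have h2 : ((Nat.find hex : ℕ) : ℝ) ≤ countEq b r := by exact_mod_cast h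
        nlinarith
      · exact Nat.find_min' hex
    have hTm : Nat.find hex ≤ m :=
      Nat.find_min' hex (by rw [sub_self, zero_mul, add_zero]; nlinarith)
    refine ⟨b, Nat.find hex, hTm, ?_, ?_⟩
    · have h1 := sum_prod_lt_le (y := y) hp0 hp hm hδ
      have h2 : (∑ a, p a * y a ^ 2) ≤ L ^ 2 + 4 := by
        calc (∑ a, p a * y a ^ 2) ≤ ∑ a, (p a * L ^ 2 + 4 * q a) :=
              Finset.sum_le_sum fun a _ => mul_log_div_sq_le (hppos a) (hqpos' a) (hpq a)
          _ = L ^ 2 + 4 := by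
              rw [Finset.sum_add_distrib, ← Finset.sum_mul, ← Finset.mul_sum, hp, hq]; ring
      have h3 : (∑ a, p a * y a ^ 2) / (m * δ ^ 2) ≤ ε :=
        le_trans (by gcongr) hε
      have h4 : (∑ r : Fin m → Fin 2, if Nat.find hex ≤ countEq b r then ∏ i, p (r i) else 0) +
          (∑ r : Fin m → Fin 2, if ∑ i, y (r i) < m * (D - δ) then ∏ i, p (r i) else 0) = 1 := by
        rw [← Finset.sum_add_distrib, ← sum_prod_eq_one hp m]
        refine Finset.sum_congr rfl fun r _ => ?_
        by_cases h : m * (D - δ) ≤ ∑ i, y (r i)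
        · rw [if_pos ((hiff r).2 h), if_neg (not_lt.2 h), add_zero]
        · rw [if_neg fun h' => h ((hiff r).1 h'), if_pos (not_le.1 h), zero_add]
      linarith
    -- Change of measure: the `q`-weight of a sequence is its `p`-weight times the exponential of
    -- minus its log-likelihood ratio, which is large on the accepted set.
    · have key : ∀ r : Fin m → Fin 2, (if Nat.find hex ≤ countEq b r then ∏ i, q (r i) else 0) ≤
          (∏ i, p (r i)) * Real.exp (-(m * (D - δ))) := by
        intro r
        have hP : 0 ≤ ∏ i, p (r i) := Finset.prod_nonneg fun i _ => hp0 _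
        split_ifs with h
        · rw [hiff] at h
          have h1 : ∏ i, q (r i) = (∏ i, p (r i)) * Real.exp (-(∑ i, y (r i))) := by
            rw [← Finset.sum_neg_distrib, Real.exp_sum, ← Finset.prod_mul_distrib]
            refine Finset.prod_congr rfl fun i _ => ?_
            rw [hy, ← Real.log_inv, Real.exp_log (inv_pos.2 (div_pos (hppos _) (hqpos' _))),
              inv_div]
            field_simp [(hppos (r i)).ne']
          rw [h1]
          gcongr
        · positivity
      calc _ ≤ ∑ r : Fin m → Fin 2, (∏ i, p (r i)) * Real.exp (-(m * (D - δ))) :=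
            Finset.sum_le_sum fun r _ => key r
        _ = _ := by rw [← Finset.sum_mul, sum_prod_eq_one hp, one_mul]

/-- Data processing: the relative entropy bounds the type II error exponent. -/
theorem mul_log_inv_sub_log_two_le {p q : ℝ} (hp0 : 0 ≤ p) (hp1 : p ≤ 1) (hq0 : 0 < q)
    (hq1 : q ≤ 1) (hpq : q = 1 → p = 1) :
    p * (-Real.log q) - Real.log 2 ≤
      p * Real.log (p / q) + (1 - p) * Real.log ((1 - p) / (1 - q)) := by
  have h := Real.binEntropy_le_log_two (p := p)
  rw [Real.binEntropy_eq_negMulLog_add_negMulLog_one_sub, Real.negMulLog, Real.negMulLog] at h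
  have h1 : p * Real.log (p / q) = p * Real.log p + p * (-Real.log q) := by
    rcases hp0.eq_or_lt with h0 | h0
    · rw [← h0]; ring
    · rw [Real.log_div h0.ne' hq0.ne']; ring
  have h2 : (1 - p) * Real.log (1 - p) ≤ (1 - p) * Real.log ((1 - p) / (1 - q)) := by
    rcases hp1.eq_or_lt with h0 | h0
    · rw [h0]; simp
    · have hq : q < 1 := lt_of_le_of_ne hq1 fun e => h0.ne (hpq e)
      rw [Real.log_div (by linarith) (by linarith)]
      have : Real.log (1 - q) ≤ 0 := Real.log_nonpos (by linarith) (by linarith)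
      nlinarith
  linarith

end Stein

end CompStein

namespace CompStein

/-! ### One-shot bounds for complexity-limited quantities -/

section OneShot

variable {ι : Type} [Fintype ι] [DecidableEq ι]

theorem coe_lt_neg_log_iff {x : ℝ} {a : ℝ≥0∞} :
    (x : EReal) < -ENNReal.log a ↔ a < ENNReal.ofReal (Real.exp (-x)) := by
  rw [EReal.lt_neg_comm, ← ENNReal.log_lt_log_iff, ENNReal.log_ofReal_of_pos (Real.exp_pos _),
    Real.log_exp, EReal.coe_neg]

theorem coe_le_neg_log_iff {x : ℝ} {a : ℝ≥0∞} :
    (x : EReal) ≤ -ENNReal.log a ↔ a ≤ ENNReal.ofReal (Real.exp (-x)) := by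
  rw [EReal.le_neg, ← ENNReal.log_le_log_iff, ENNReal.log_ofReal_of_pos (Real.exp_pos _),
    Real.log_exp, EReal.coe_neg]

theorem le_exp_mul_of_maxRelEntropy_le {K : ℕ} {p q : Fin K → ℝ} (hq : ∀ r, 0 ≤ q r) {L : ℝ}
    (h : maxRelEntropy p q ≤ L) (r : Fin K) : p r ≤ Real.exp L * q r := by
  have h1 : (L : EReal) = ENNReal.log (ENNReal.ofReal (Real.exp L)) := by
    rw [ENNReal.log_ofReal_of_pos (Real.exp_pos _), Real.log_exp]
  rw [maxRelEntropy, h1, ENNReal.log_le_log_iff] at h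
  have h2 := (le_iSup (fun r => ENNReal.ofReal (p r) / ENNReal.ofReal (q r)) r).trans h
  rw [ENNReal.div_le_iff_le_mul (Or.inr (by simp)) (Or.inl ENNReal.ofReal_ne_top),
    ← ENNReal.ofReal_mul (Real.exp_pos _).le] at h2
  exact (ENNReal.ofReal_le_ofReal_iff (mul_nonneg (Real.exp_pos _).le (hq r))).1 h2

theorem le_measuredDivergence {K G : ℕ} (D : (Fin K → ℝ) → (Fin K → ℝ) → EReal) (ρ σ : Op ι)
    {M : Fin K → Op ι} (hM : M ∈ measurements ι G K) :
    D (fun r => prob (M r) ρ) (fun r => prob (M r) σ) ≤ measuredDivergence D ρ σ G :=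
  le_iSup₂ (f := fun (M : Fin K → Op ι) (_ : M ∈ measurements ι G K) =>
    D (fun r => prob (M r) ρ) (fun r => prob (M r) σ)) M hM

/-- The converse bound: the measured relative entropy bounds the type II error exponent. -/
theorem le_measuredDivergence_relEntropy {ρ σ : Op ι} (hρ : IsState ρ) (hσ : IsState σ)
    {ε x : ℝ} (hε : ε < 1) {G G' : ℕ}
    (hG : G + (10 * (Fintype.card ι + 2 * G) ^ 2 + 1) ≤ G')
    (hx : (x : EReal) < hypothesisTestingRelEntropy ε ρ σ G) :
    (((1 - ε) * x - Real.log 2 : ℝ) : EReal) ≤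
      measuredDivergence (K := 2) relEntropy ρ σ G' := by
  -- The strict inequality supplies an actual test, whether or not the minimum is attained.
  rw [hypothesisTestingRelEntropy, coe_lt_neg_log_iff, typeIIError, iInf_lt_iff] at hx
  obtain ⟨Λ, hx⟩ := hx
  rw [iInf_lt_iff] at hx
  obtain ⟨⟨hΛ, hΛρ⟩, hx⟩ := hx
  rw [ENNReal.ofReal_lt_ofReal_iff (Real.exp_pos _)] at hx
  obtain ⟨M, hM, hMprob⟩ := exists_measurement_of_mem_effects hΛ
  refine le_trans ?_ (le_measuredDivergence relEntropy ρ σ (measurements_mono hG hM))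
  obtain ⟨hρ0, hρ1, hp0, hp1⟩ := hMprob ρ hρ
  obtain ⟨hσ0, hσ1, hq0, hq1⟩ := hMprob σ hσ
  rw [relEntropy]
  split_ifs with hdom
  · exact le_top
  · have hdom' : ∀ r, prob (M r) σ = 0 → prob (M r) ρ = 0 := by
      intro r h
      by_contra h'
      exact hdom ⟨r, h, h'⟩
    rw [EReal.coe_le_coe_iff, Fin.sum_univ_two, hρ0, hρ1, hσ0, hσ1]
    set p := prob Λ ρ
    set q := prob Λ σ
    have hq : 0 < q := by
      refine lt_of_le_of_ne hq0 fun h => ?_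
      have := hdom' 0 (by rw [hσ0]; exact h.symm)
      rw [hρ0] at this
      linarith
    have hpq : q = 1 → p = 1 := by
      intro h
      have := hdom' 1 (by rw [hσ1, h, sub_self])
      rw [hρ1] at this
      linarith
    have h1 := mul_log_inv_sub_log_two_le hp0 hp1 hq hq1 hpq
    have h2 : x ≤ -Real.log q := by
      have := (Real.log_lt_iff_lt_exp hq).2 hx
      linarith
    have h3 : 0 ≤ -Real.log q := by
      have := Real.log_nonpos hq0 hq1
      linarith
    have h4 : (1 - ε) * x ≤ p * (-Real.log q) := by
      calc (1 - ε) * x ≤ (1 - ε) * (-Real.log q) := by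
            apply mul_le_mul_of_nonneg_left h2; linarith
        _ ≤ p * (-Real.log q) := by gcongr
    linarith

/-- The achievability bound: a measurement on `s` copies yields a test on `m s` copies. -/
theorem le_hypothesisTestingRelEntropy {ρ σ : Op ι} (hρ : IsState ρ) (hσ : IsState σ)
    {s G : ℕ} {M : Fin 2 → Op (Fin s × ι)} (hM : M ∈ measurements (Fin s × ι) G 2)
    {D L δ ε : ℝ} {m t G' : ℕ} (ht : t = m * s) (hm : 0 < m) (hδ : 0 < δ)
    (hε : (L ^ 2 + 4) / (m * δ ^ 2) ≤ ε) (hG : m * G + (10 * (m * m) + 1) ≤ G')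
    (hD : (D : EReal) ≤ relEntropy (fun r => prob (M r) (tensorPow ρ s))
      fun r => prob (M r) (tensorPow σ s))
    (hL : maxRelEntropy (fun r => prob (M r) (tensorPow ρ s))
      (fun r => prob (M r) (tensorPow σ s)) ≤ L) :
    ((m * (D - δ) : ℝ) : EReal) ≤
      hypothesisTestingRelEntropy ε (tensorPow ρ t) (tensorPow σ t) G' := by
  subst ht
  set p : Fin 2 → ℝ := fun r => prob (M r) (tensorPow ρ s) with hp
  set q : Fin 2 → ℝ := fun r => prob (M r) (tensorPow σ s) with hq
  have hp0 : ∀ r, 0 ≤ p r := prob_nonneg_of_mem_measurements hM (isState_tensorPow hρ s)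
  have hq0 : ∀ r, 0 ≤ q r := prob_nonneg_of_mem_measurements hM (isState_tensorPow hσ s)
  have hp1 : ∑ r, p r = 1 := by
    rw [Fin.sum_univ_two]; exact prob_add_of_mem_measurements hM (isState_tensorPow hρ s)
  have hq1 : ∑ r, q r = 1 := by
    rw [Fin.sum_univ_two]; exact prob_add_of_mem_measurements hM (isState_tensorPow hσ s)
  have hpq := le_exp_mul_of_maxRelEntropy_le hq0 hL
  have hD' : D ≤ ∑ r, p r * Real.log (p r / q r) := by
    rw [relEntropy, if_neg, EReal.coe_le_coe_iff] at hD
    · exact hD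
    · rintro ⟨r, h1, h2⟩
      have := hpq r
      rw [h1, mul_zero] at this
      exact h2 (le_antisymm this (hp0 r))
  obtain ⟨b, T, hT, h1, h2⟩ := exists_threshold_test hp0 hp1 hq0 hq1 hpq hm hδ hε
  obtain ⟨M', -, hM', hprob⟩ := exists_block_measurement hM m T b
  have hG' : m * G + (10 * (m * T) + 1) ≤ G' := by
    refine le_trans ?_ hG
    gcongr
  rw [hypothesisTestingRelEntropy, coe_le_neg_log_iff, typeIIError]
  have hmem : M' 0 ∈ {Λ | Λ ∈ effects (Fin (m * s) × ι) G' ∧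
      1 - ε ≤ prob Λ (tensorPow ρ (m * s))} :=
    ⟨effects_mono hG' hM', by rw [hprob ρ hρ]; exact h1⟩
  refine (iInf₂_le (M' 0) hmem).trans ?_
  apply ENNReal.ofReal_le_ofReal
  rw [hprob σ hσ]
  exact h2.trans (Real.exp_le_exp.2 (by gcongr))

/-- The measured max-relative entropy is superadditive. -/
theorem le_measuredDivergence_maxRelEntropy {ρ σ : Op ι} (hρ : IsState ρ) (hσ : IsState σ)
    {s G m t G' : ℕ} {x : ℝ} (ht : t = m * s) (hG : m * G + (10 * (m * m) + 1) ≤ G')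
    (hx : (x : EReal) <
      measuredDivergence (K := 2) maxRelEntropy (tensorPow ρ s) (tensorPow σ s) G) :
    ((m * x : ℝ) : EReal) ≤
      measuredDivergence (K := 2) maxRelEntropy (tensorPow ρ t) (tensorPow σ t) G' := by
  subst ht
  rw [measuredDivergence, lt_iSup_iff] at hx
  obtain ⟨M, hx⟩ := hx
  rw [lt_iSup_iff] at hx
  obtain ⟨hM, hx⟩ := hx
  have hexp : ∀ x : ℝ, (x : EReal) = ENNReal.log (ENNReal.ofReal (Real.exp x)) := fun x => by
    rw [ENNReal.log_ofReal_of_pos (Real.exp_pos _), Real.log_exp]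
  rw [maxRelEntropy, hexp, ENNReal.log_lt_log_iff, lt_iSup_iff] at hx
  obtain ⟨b, hx⟩ := hx
  -- With threshold `m` the measurement accepts only if every block gives `b`, which raises the
  -- likelihood ratio to the power `m`.
  obtain ⟨M', hM', -, hprob⟩ := exists_block_measurement hM m m b
  refine le_trans ?_ (le_measuredDivergence maxRelEntropy _ _ (measurements_mono hG hM'))
  rw [maxRelEntropy, hexp, ENNReal.log_le_log_iff]
  refine le_trans ?_ (le_iSup (fun r => ENNReal.ofReal (prob (M' r) (tensorPow ρ (m * s))) /
    ENNReal.ofReal (prob (M' r) (tensorPow σ (m * s)))) 0)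
  have h1 : ∀ ρ : Op ι, IsState ρ →
      prob (M' 0) (tensorPow ρ (m * s)) = prob (M b) (tensorPow ρ s) ^ m := fun ρ hρ =>
    (hprob ρ hρ).trans (sum_le_countEq_self b fun r => prob (M r) (tensorPow ρ s))
  rw [h1 ρ hρ, h1 σ hσ,
    ENNReal.ofReal_pow (prob_nonneg_of_mem_measurements hM (isState_tensorPow hρ s) b),
    ENNReal.ofReal_pow (prob_nonneg_of_mem_measurements hM (isState_tensorPow hσ s) b),
    div_eq_mul_inv, ENNReal.inv_pow, ← mul_pow, ← div_eq_mul_inv, Real.exp_nat_mul,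
    ENNReal.ofReal_pow (Real.exp_pos _).le]
  exact pow_le_pow_left₀ zero_le hx.le m

end OneShot

end CompStein

namespace CompStein

/-! ### The pseudometric and the order, expressed with inverse powers -/

section Asymptotics

/-- `n^{-K}`. -/
noncomputable def invPow (K n : ℕ) : ℝ := ((n : ℝ) ^ K)⁻¹

theorem invPow_nonneg (K n : ℕ) : 0 ≤ invPow K n := by unfold invPow; positivity

theorem invPow_pos {K n : ℕ} (hn : 0 < n) : 0 < invPow K n := by
  unfold invPow
  have : (0 : ℝ) < n := by exact_mod_cast hn
  positivity

theorem invPow_anti {K K' n : ℕ} (hn : 0 < n) (h : K ≤ K') : invPow K' n ≤ invPow K n := by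
  unfold invPow
  have h1 : (1 : ℝ) ≤ n := by exact_mod_cast hn
  exact inv_anti₀ (by positivity) (pow_le_pow_right₀ h1 h)

theorem mul_invPow_succ_le {c : ℝ} {K n : ℕ} (hn : 0 < n) (hc : c ≤ n) :
    c * invPow (K + 1) n ≤ invPow K n := by
  have h0 : (0 : ℝ) < n := by exact_mod_cast hn
  have h1 : (n : ℝ) * invPow (K + 1) n = invPow K n := by
    unfold invPow
    rw [pow_succ]
    field_simp
  rw [← h1]
  exact mul_le_mul_of_nonneg_right hc (invPow_nonneg _ _)

/-- One power of `n` absorbs any constant. Estimates are therefore made with exponent `K + 1` and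
concluded with `K`. -/
theorem eventually_mul_invPow_succ_le (c : ℝ) (K : ℕ) :
    ∀ᶠ n in atTop, c * invPow (K + 1) n ≤ invPow K n := by
  filter_upwards [eventually_gt_atTop 0, tendsto_natCast_atTop_atTop.eventually_ge_atTop c]
    with n hn hc
  exact mul_invPow_succ_le hn hc

theorem rpow_neg_natCast_eq_invPow (K n : ℕ) : (n : ℝ) ^ (-(K : ℝ)) = invPow K n := by
  rw [Real.rpow_neg (Nat.cast_nonneg n), Real.rpow_natCast, invPow]

theorem eventually_abs_sub_le_of_asympDist_lt {f g : ℕ → ℝ} {s : ℝ}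
    (h : asympDist f g < ENNReal.ofReal (Real.exp s)) :
    ∀ᶠ n : ℕ in atTop, |f n - g n| ≤ (n : ℝ) ^ s := by
  filter_upwards [eventually_lt_of_limsup_lt h, eventually_ge_atTop 2] with n hn h2
  have hn1 : (1 : ℝ) < n := by exact_mod_cast h2
  by_cases hfg : f n = g n
  · rw [hfg, sub_self, abs_zero]
    positivity
  · rw [if_neg hfg, ENNReal.ofReal_lt_ofReal_iff (Real.exp_pos _), Real.exp_lt_exp,
      div_lt_iff₀ (Real.log_pos hn1), ← Real.log_rpow (by linarith)] at hn
    exact ((Real.log_lt_log_iff (abs_pos.2 (sub_ne_zero.2 hfg)) (by positivity)).1 hn).le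

theorem asympDist_le_of_eventually {f g : ℕ → ℝ} {s : ℝ}
    (h : ∀ᶠ n : ℕ in atTop, |f n - g n| ≤ (n : ℝ) ^ s) :
    asympDist f g ≤ ENNReal.ofReal (Real.exp s) := by
  refine limsup_le_of_le (by isBoundedDefault) ?_
  filter_upwards [h, eventually_ge_atTop 2] with n hn h2
  have hn1 : (1 : ℝ) < n := by exact_mod_cast h2
  split_ifs with hfg
  · exact zero_le
  · apply ENNReal.ofReal_le_ofReal
    rw [Real.exp_le_exp, div_le_iff₀ (Real.log_pos hn1), ← Real.log_rpow (by linarith)]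
    exact Real.log_le_log (abs_pos.2 (sub_ne_zero.2 hfg)) hn

theorem eventually_abs_sub_le_invPow {f g : ℕ → ℝ} {K : ℕ}
    (h : asympDist f g < ENNReal.ofReal (Real.exp (-(K : ℝ)))) :
    ∀ᶠ n : ℕ in atTop, |f n - g n| ≤ invPow K n := by
  filter_upwards [eventually_abs_sub_le_of_asympDist_lt h] with n hn
  rwa [rpow_neg_natCast_eq_invPow] at hn

theorem asympDist_le_of_invPow {f g : ℕ → ℝ} {K : ℕ}
    (h : ∀ᶠ n : ℕ in atTop, |f n - g n| ≤ invPow K n) :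
    asympDist f g ≤ ENNReal.ofReal (Real.exp (-(K : ℝ))) := by
  apply asympDist_le_of_eventually
  filter_upwards [h] with n hn
  rwa [rpow_neg_natCast_eq_invPow]

theorem ofReal_exp_neg_pos (K : ℕ) : 0 < ENNReal.ofReal (Real.exp (-(K : ℝ))) :=
  ENNReal.ofReal_pos.2 (Real.exp_pos _)

theorem exists_ofReal_exp_neg_lt {δ : ℝ≥0∞} (hδ : 0 < δ) :
    ∃ K₀ : ℕ, ∀ K ≥ K₀, ENNReal.ofReal (Real.exp (-(K : ℝ))) < δ := by
  have h : Tendsto (fun K : ℕ => ENNReal.ofReal (Real.exp (-(K : ℝ)))) atTop (𝓝 0) := by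
    rw [← ENNReal.ofReal_zero]
    exact ENNReal.tendsto_ofReal (Real.tendsto_exp_neg_atTop_nhds_zero.comp
      tendsto_natCast_atTop_atTop)
  exact eventually_atTop.1 (h.eventually (gt_mem_nhds hδ))

theorem asympDist_eq_zero_iff {f g : ℕ → ℝ} :
    asympDist f g = 0 ↔ ∀ K : ℕ, ∀ᶠ n in atTop, |f n - g n| ≤ invPow K n := by
  constructor
  · intro h K
    exact eventually_abs_sub_le_invPow (h ▸ ofReal_exp_neg_pos K)
  · intro h
    by_contra h0
    obtain ⟨K, hK⟩ := exists_ofReal_exp_neg_lt (pos_iff_ne_zero.2 h0)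
    exact absurd (asympDist_le_of_invPow (h K)) (not_le.2 (hK K le_rfl))

theorem PolyBounded.exists_pow {f : ℕ → ℝ} (h : PolyBounded f) :
    ∃ c : ℕ, ∀ᶠ n : ℕ in atTop, |f n| ≤ (n : ℝ) ^ c := by
  obtain ⟨c, hc⟩ := exists_nat_gt (asympDist f 0).toReal
  refine ⟨c, ?_⟩
  have h1 : asympDist f 0 < ENNReal.ofReal (Real.exp c) := by
    rw [← ENNReal.ofReal_toReal h.ne, ENNReal.ofReal_lt_ofReal_iff (Real.exp_pos _)]
    have := Real.add_one_le_exp (c : ℝ)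
    linarith
  filter_upwards [eventually_abs_sub_le_of_asympDist_lt h1] with n hn
  simpa using hn

theorem polyBounded_of_eventually {f : ℕ → ℝ} {c : ℕ} (h : ∀ᶠ n : ℕ in atTop, |f n| ≤ (n : ℝ) ^ c) :
    PolyBounded f := by
  refine lt_of_le_of_lt (asympDist_le_of_eventually (s := c) ?_) ENNReal.ofReal_lt_top
  filter_upwards [h] with n hn
  simpa using hn

theorem neglLE_ext_iff {a b : ℕ → ℝ} :
    NeglLE (ext a) (ext b) ↔ ∀ K : ℕ, ∀ᶠ n in atTop, a n ≤ b n + invPow K n := by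
  constructor
  · rintro ⟨h, hh, hab⟩ K
    filter_upwards [hab, asympDist_eq_zero_iff.1 hh K] with n h1 h2
    have h3 : a n ≤ b n + h n := by
      simp only [ext] at h1
      exact_mod_cast h1
    have h4 := le_abs_self (h n)
    simp only [Pi.zero_apply, sub_zero] at h2
    linarith
  · intro h
    refine ⟨fun n => max (a n - b n) 0, asympDist_eq_zero_iff.2 fun K => ?_, ?_⟩
    · filter_upwards [h K] with n hn
      rw [Pi.zero_apply, sub_zero, abs_of_nonneg (le_max_right _ _)]
      exact max_le (by linarith) (invPow_nonneg K n)
    · refine Eventually.of_forall fun n => ?_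
      simp only [ext]
      have : a n ≤ b n + max (a n - b n) 0 := by linarith [le_max_left (a n - b n) 0]
      exact_mod_cast this

theorem NeglLE.eventually_le {a : ℕ → ℝ} {u : ℕ → EReal} (h : NeglLE (ext a) u) (K : ℕ) :
    ∀ᶠ n in atTop, ((a n - invPow K n : ℝ) : EReal) ≤ u n := by
  obtain ⟨h, hh, hab⟩ := h
  filter_upwards [hab, asympDist_eq_zero_iff.1 hh K] with n h1 h2
  simp only [Pi.zero_apply, sub_zero] at h2
  simp only [ext] at h1
  have h4 := le_abs_self (h n)
  rw [EReal.coe_sub]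
  refine EReal.sub_le_of_le_add (h1.trans ?_)
  gcongr
  exact_mod_cast h4.trans h2

theorem neglLE_of_eventually {a : ℕ → ℝ} {u : ℕ → EReal}
    (h : ∀ᶠ n in atTop, ((a n : ℝ) : EReal) ≤ u n) : NeglLE (ext a) u := by
  refine ⟨0, asympDist_eq_zero_iff.2 fun K => ?_, ?_⟩
  · refine Eventually.of_forall fun n => ?_
    simpa using invPow_nonneg K n
  · filter_upwards [h] with n hn
    simpa [ext] using hn

theorem NeglLE.trans_ext {a b c : ℕ → ℝ} (h₁ : NeglLE (ext a) (ext b))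
    (h₂ : NeglLE (ext b) (ext c)) : NeglLE (ext a) (ext c) := by
  rw [neglLE_ext_iff] at *
  intro K
  filter_upwards [h₁ (K + 1), h₂ (K + 1), eventually_mul_invPow_succ_le 2 K] with n h1 h2 h3
  linarith

theorem LiminfLE.mono {u : ℕ → ℕ → EReal} {b b' : ℕ → ℝ} (h : LiminfLE u b)
    (hb : ∀ᶠ n in atTop, b n ≤ b' n) : LiminfLE u b' := fun a ha =>
  (h a ha).trans_ext (neglLE_of_eventually (by
    filter_upwards [hb] with n hn
    simpa [ext] using hn))

/-- This allows an arbitrary upper bound to be truncated at a polynomial one. -/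
theorem LiminfLE.min {u : ℕ → ℕ → EReal} {b b' : ℕ → ℝ} (h : LiminfLE u b) (h' : LiminfLE u b') :
    LiminfLE u fun n => min (b n) (b' n) := by
  intro a ha
  have h1 := neglLE_ext_iff.1 (h a ha)
  have h2 := neglLE_ext_iff.1 (h' a ha)
  rw [neglLE_ext_iff]
  intro K
  filter_upwards [h1 K, h2 K] with n h1 h2
  rw [← min_add_add_right]
  exact le_min h1 h2

/-- Distance less than `exp (-K)` means difference at most `n^{-K}` eventually, so the nearby
function can be replaced by an explicit shift of `f`. -/
theorem LiminfLEWithin.liminfLE {K : ℕ} {u : ℕ → ℕ → EReal} {f : ℕ → ℝ}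
    (h : LiminfLEWithin (ENNReal.ofReal (Real.exp (-(K : ℝ)))) u f) :
    LiminfLE u fun n => f n + invPow K n := by
  obtain ⟨g, hg, hu⟩ := h
  refine hu.mono ?_
  filter_upwards [eventually_abs_sub_le_invPow hg] with n hn
  linarith [le_abs_self (g n - f n)]

theorem LiminfLE.within {K : ℕ} {δ : ℝ≥0∞} (hK : ENNReal.ofReal (Real.exp (-(K : ℝ))) < δ)
    {u : ℕ → ℕ → EReal} {f : ℕ → ℝ} (h : LiminfLE u fun n => f n + invPow K n) :
    LiminfLEWithin δ u f := by
  refine ⟨_, lt_of_le_of_lt (asympDist_le_of_invPow (Eventually.of_forall fun n => ?_)) hK, h⟩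
  rw [add_sub_cancel_left, abs_of_nonneg (invPow_nonneg K n)]

theorem LELiminfWithin.leLiminf {K : ℕ} {u : ℕ → ℕ → EReal} {f : ℕ → ℝ}
    (h : LELiminfWithin (ENNReal.ofReal (Real.exp (-(K : ℝ)))) f u) :
    LELiminf (fun n => f n - invPow K n) u := by
  obtain ⟨g, hg, hu⟩ := h
  intro b hb
  refine NeglLE.trans_ext (b := g) (neglLE_of_eventually ?_) (hu b hb)
  filter_upwards [eventually_abs_sub_le_invPow hg] with n hn
  simp only [ext]
  have := neg_abs_le (g n - f n)
  exact_mod_cast (by linarith : f n - invPow K n ≤ g n)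

theorem LELiminf.within {K : ℕ} {δ : ℝ≥0∞} (hK : ENNReal.ofReal (Real.exp (-(K : ℝ))) < δ)
    {u : ℕ → ℕ → EReal} {f : ℕ → ℝ} (h : LELiminf (fun n => f n - invPow K n) u) :
    LELiminfWithin δ f u := by
  refine ⟨_, lt_of_le_of_lt (asympDist_le_of_invPow (Eventually.of_forall fun n => ?_)) hK, h⟩
  rw [sub_sub_cancel_left, abs_neg, abs_of_nonneg (invPow_nonneg K n)]

/-- The shift by two keeps the value strictly between zero and one also at `n = 0` and `n = 1`. -/
theorem isErrorFunction_inv_pow (K : ℕ) (hK : 0 < K) :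
    IsErrorFunction (fun n => (((n : ℝ) + 2) ^ K)⁻¹) := by
  have h1 : ∀ n : ℕ, (1 : ℝ) < ((n : ℝ) + 2) ^ K := fun n =>
    one_lt_pow₀ (by linarith [(Nat.cast_nonneg n : (0 : ℝ) ≤ n)]) hK.ne'
  refine ⟨fun n => ⟨by positivity, inv_lt_one_of_one_lt₀ (h1 n)⟩,
    polyBounded_of_eventually (c := 2 * K) ?_⟩
  filter_upwards [eventually_ge_atTop 2] with n hn
  have hn' : (2 : ℝ) ≤ n := by exact_mod_cast hn
  rw [inv_inv, abs_of_nonneg (by positivity), pow_mul]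
  gcongr
  nlinarith

theorem eventually_inv_pow_le_invPow (K : ℕ) :
    ∀ᶠ n : ℕ in atTop, (((n : ℝ) + 2) ^ K)⁻¹ ≤ invPow K n := by
  filter_upwards [eventually_gt_atTop 0] with n hn
  have hn' : (0 : ℝ) < n := by exact_mod_cast hn
  unfold invPow
  apply inv_anti₀ (by positivity)
  gcongr
  linarith

theorem isErrorFunction_const {ε : ℝ} (h0 : 0 < ε) (h1 : ε < 1) :
    IsErrorFunction (fun _ => ε) := by
  refine ⟨fun _ => ⟨h0, h1⟩, polyBounded_of_eventually (c := 1) ?_⟩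
  filter_upwards [tendsto_natCast_atTop_atTop.eventually_ge_atTop ε⁻¹] with n hn
  rw [abs_of_pos (inv_pos.2 h0), pow_one]
  exact hn

end Asymptotics

end CompStein

namespace CompStein

/-! ### Transport of upper bounds between testing and measured rates -/

section Rates

theorem coe_le_inv_mul_iff {c y : ℝ} (hc : 0 < c) (X : EReal) :
    (y : EReal) ≤ ((c⁻¹ : ℝ) : EReal) * X ↔ ((c * y : ℝ) : EReal) ≤ X := by
  have hc' : 0 < c⁻¹ := inv_pos.2 hc
  induction X with
  | bot =>
    rw [EReal.coe_mul_bot_of_pos hc']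
    simp only [le_bot_iff, EReal.coe_ne_bot]
  | top =>
    rw [EReal.coe_mul_top_of_pos hc']
    simp only [le_top]
  | coe x =>
    rw [← EReal.coe_mul, EReal.coe_le_coe_iff, EReal.coe_le_coe_iff, inv_mul_eq_div,
      le_div_iff₀ hc, mul_comm]

theorem inv_mul_le_coe_iff {c y : ℝ} (hc : 0 < c) (X : EReal) :
    ((c⁻¹ : ℝ) : EReal) * X ≤ (y : EReal) ↔ X ≤ ((c * y : ℝ) : EReal) := by
  have hc' : 0 < c⁻¹ := inv_pos.2 hc
  induction X with
  | bot =>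
    rw [EReal.coe_mul_bot_of_pos hc']
    simp only [bot_le]
  | top =>
    rw [EReal.coe_mul_top_of_pos hc']
    simp only [top_le_iff, EReal.coe_ne_top]
  | coe x =>
    rw [← EReal.coe_mul, EReal.coe_le_coe_iff, EReal.coe_le_coe_iff, inv_mul_eq_div,
      div_le_iff₀ hc, mul_comm]

/-- The budget for `n^j` blocks of `n^k` copies. The increase of `l` must not depend on `k` or `j`;
the factor `12 = 1 + 10 + 1` costs one more power of `n`. -/
theorem block_complexity_le {n j k l l' : ℕ} (hn : 12 ≤ n) (hj : 1 ≤ j) (hl : l + 10 ≤ l') :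
    n ^ j * n ^ (k * l) + (10 * (n ^ j * n ^ j) + 1) ≤ n ^ ((k + j) * l') := by
  have hn0 : 1 ≤ n := by omega
  have h1 : n ^ j * n ^ (k * l) ≤ n ^ (k * l + 9 * j) := by
    rw [← pow_add]; exact Nat.pow_le_pow_right hn0 (by omega)
  have h2 : n ^ j * n ^ j ≤ n ^ (k * l + 9 * j) := by
    rw [← pow_add]; exact Nat.pow_le_pow_right hn0 (by omega)
  have h3 : 1 ≤ n ^ (k * l + 9 * j) := Nat.one_le_pow _ _ hn0
  have h4 : n ^ (k * l + 9 * j + 1) ≤ n ^ ((k + j) * l') := by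
    apply Nat.pow_le_pow_right hn0
    calc k * l + 9 * j + 1 ≤ (k + j) * (l + 10) := by
          have : 0 ≤ j * l := Nat.zero_le _
          nlinarith
      _ ≤ (k + j) * l' := Nat.mul_le_mul_left _ hl
  rw [pow_succ] at h4
  nlinarith

/-- The budget for turning a test into a measurement. The square doubles `l`, and `92 = 1 + 10 * 3 ^
2 + 1`. -/
theorem conjunction_complexity_le {n c k l l' s : ℕ} (hn : 92 ≤ n) (hk : 1 ≤ k)
    (hs : s ≤ n ^ c) (hl : 2 * l + (2 * c + 3) ≤ l') :
    n ^ (k * l) + (10 * (n ^ k * s + 2 * n ^ (k * l)) ^ 2 + 1) ≤ n ^ (k * l') := by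
  have hn0 : 1 ≤ n := by omega
  set E := k + c + k * l with hE
  have h1 : n ^ k * s ≤ n ^ E :=
    (Nat.mul_le_mul_left _ hs).trans (by
      rw [← pow_add]; exact Nat.pow_le_pow_right hn0 (by omega))
  have h2 : n ^ (k * l) ≤ n ^ E := Nat.pow_le_pow_right hn0 (by omega)
  have h3 : 1 ≤ n ^ E := Nat.one_le_pow _ _ hn0
  have h4 : n ^ (2 * E + 1) ≤ n ^ (k * l') := by
    apply Nat.pow_le_pow_right hn0
    calc 2 * E + 1 ≤ k * (2 * l + (2 * c + 3)) := by
          have : c ≤ k * c := Nat.le_mul_of_pos_left c hk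
          rw [hE]; nlinarith
      _ ≤ k * l' := Nat.mul_le_mul_left _ hl
  have h5 : (n ^ k * s + 2 * n ^ (k * l)) ^ 2 ≤ (3 * n ^ E) ^ 2 :=
    Nat.pow_le_pow_left (by omega) 2
  have h6 : n ^ (2 * E + 1) = n ^ E * n ^ E * n := by ring
  have h7 : n ^ E ≤ n ^ E * n ^ E := Nat.le_mul_of_pos_left _ h3
  calc n ^ (k * l) + (10 * (n ^ k * s + 2 * n ^ (k * l)) ^ 2 + 1)
      ≤ n ^ E * n ^ E * 92 := by nlinarith
    _ ≤ n ^ E * n ^ E * n := Nat.mul_le_mul_left _ hn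
    _ ≤ _ := h6 ▸ h4

theorem exists_mem_measurements (ι : Type) [Fintype ι] [DecidableEq ι] (G : ℕ) :
    ∃ M, M ∈ measurements ι G 2 := by
  refine ⟨_, 1, 1, ![flag (Sum.inr 0) 0, flag (Sum.inr 0) 1],
    gateComplexity_le_iff.2 (HasCircuit.one.mono (Nat.zero_le G)), fun r q => ?_, ?_,
    fun r => rfl⟩
  · fin_cases r
    · exact flag_cases _ 0 q
    · exact flag_cases _ 1 q
  · rw [Fin.sum_univ_two]
    exact sum_tensorOp_flag _

/-- Both distributions have total mass one, so some outcome has positive probability under `ρ`, at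
least that under `σ`. -/
theorem measuredDivergence_maxRelEntropy_nonneg {ι : Type} [Fintype ι] [DecidableEq ι]
    {ρ σ : Op ι} (hρ : IsState ρ) (hσ : IsState σ) (G : ℕ) :
    0 ≤ measuredDivergence (K := 2) maxRelEntropy ρ σ G := by
  obtain ⟨M, hM⟩ := exists_mem_measurements ι G
  refine le_trans ?_ (le_measuredDivergence maxRelEntropy ρ σ hM)
  have hp := prob_add_of_mem_measurements hM hρ
  have hq := prob_add_of_mem_measurements hM hσ
  have hp0 := prob_nonneg_of_mem_measurements hM hρ
  have hq0 := prob_nonneg_of_mem_measurements hM hσ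
  obtain ⟨r, hr, hr0⟩ : ∃ r : Fin 2, prob (M r) σ ≤ prob (M r) ρ ∧ 0 < prob (M r) ρ := by
    by_contra! h
    have h0 := h 0
    have h1 := h 1
    rcases le_or_gt (prob (M 0) σ) (prob (M 0) ρ) with h2 | h2
    · rcases le_or_gt (prob (M 1) σ) (prob (M 1) ρ) with h3 | h3 
      · linarith [h0 h2, h1 h3]
      · linarith [h0 h2, hq0 0]
    · linarith [h1 (by linarith), hq0 1]
  rw [maxRelEntropy, ENNReal.zero_le_log_iff]
  refine le_trans ?_ (le_iSup (fun r => ENNReal.ofReal (prob (M r) ρ) /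
    ENNReal.ofReal (prob (M r) σ)) r)
  rw [ENNReal.le_div_iff_mul_le (Or.inr (by simpa using hr0)) (Or.inl ENNReal.ofReal_ne_top),
    one_mul]
  exact ENNReal.ofReal_le_ofReal hr

theorem relEntropy_le_of_maxRelEntropy_le {K : ℕ} {p q : Fin K → ℝ} (hp : ∀ r, 0 ≤ p r)
    (hp1 : ∑ r, p r = 1) (hq : ∀ r, 0 ≤ q r) {L : ℝ} (h : maxRelEntropy p q ≤ L) :
    relEntropy p q ≤ L := by
  have hpq := le_exp_mul_of_maxRelEntropy_le hq h
  rw [relEntropy, if_neg, EReal.coe_le_coe_iff]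
  · calc ∑ r, p r * Real.log (p r / q r) ≤ ∑ r, p r * L := by
          refine Finset.sum_le_sum fun r _ => ?_
          rcases (hp r).eq_or_lt with h0 | h0
          · rw [← h0, zero_mul, zero_mul]
          · have hqr : 0 < q r := by
              have := hpq r
              by_contra h'
              have h1 : q r = 0 := le_antisymm (not_lt.1 h') (hq r)
              rw [h1, mul_zero] at this
              linarith
            refine mul_le_mul_of_nonneg_left ?_ (hp r)
            rw [Real.log_le_iff_le_exp (by positivity), div_le_iff₀ hqr]
            exact hpq r
      _ = L := by rw [← Finset.sum_mul, hp1, one_mul]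
  · rintro ⟨r, h1, h2⟩
    have := hpq r
    rw [h1, mul_zero] at this
    exact h2 (le_antisymm this (hp r))

variable {N : ℕ → ℕ} {ρ σ : ∀ n, Op (Fin (N n))}

/-- By superadditivity, a large rate at one `k` persists at all larger `k'` and slightly larger
`l'`, and so is seen by the limit that is assumed to be bounded. -/
theorem exists_pow_bound_measuredRate_max (hρ : ∀ n, IsState (ρ n)) (hσ : ∀ n, IsState (σ n))
    (hmax : CompMeasuredMaxRelEntropyPolyBounded ρ σ) :
    ∃ c : ℕ, ∀ l k, ∀ᶠ n in atTop,
      measuredRate maxRelEntropy ρ σ l k n ≤ (((n : ℝ) ^ c : ℝ) : EReal) := by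
  classical
  obtain ⟨p, hp, hlim⟩ := hmax
  obtain ⟨c, hc⟩ := hp.exists_pow
  have h1 := hlim _ (ofReal_exp_neg_pos 0)
  refine ⟨c + 2, fun l k => ?_⟩
  obtain ⟨l', hl', hlE⟩ := (h1.and (eventually_ge_atTop (l + 10))).exists
  have hub := hl'.liminfLE
  -- Large exactly at the `n` that violate the bound, and zero elsewhere, where nonnegativity
  -- suffices. The exponent `c + 2` leaves room for the two error terms of size one.
  set a : ℕ → ℝ := fun n =>
    if (((n : ℝ) ^ (c + 2) : ℝ) : EReal) < measuredRate maxRelEntropy ρ σ l k n then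
      (n : ℝ) ^ (c + 2) else 0 with ha
  have hau : ∀ᶠ k' in atTop, NeglLE (ext a) (measuredRate maxRelEntropy ρ σ l' k') := by
    filter_upwards [eventually_ge_atTop (k + 1)] with k' hk'
    obtain ⟨j, rfl⟩ := Nat.exists_eq_add_of_le (show k ≤ k' by omega)
    apply neglLE_of_eventually
    filter_upwards [eventually_ge_atTop 12] with n hn
    have hn0 : (0 : ℝ) < n := by exact_mod_cast (by omega : 0 < n)
    rw [measuredRate, coe_le_inv_mul_iff (by positivity)]
    simp only [ha]
    split_ifs with h
    · rw [← not_le, measuredRate, inv_mul_le_coe_iff (by positivity), not_le] at h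
      have := le_measuredDivergence_maxRelEntropy (hρ n) (hσ n)
        (show n ^ (k + j) = n ^ j * n ^ k by rw [pow_add, mul_comm])
        (block_complexity_le hn (by omega) hlE) h
      convert this using 2
      push_cast
      ring
    · rw [mul_zero]
      exact measuredDivergence_maxRelEntropy_nonneg (isState_tensorPow (hρ n) _)
        (isState_tensorPow (hσ n) _) _
  filter_upwards [neglLE_ext_iff.1 (hub a hau) 0, hc, eventually_ge_atTop 3] with n h2 h3 h4
  by_contra h
  rw [not_le] at h
  simp only [ha, if_pos h] at h2
  have hn : (3 : ℝ) ≤ n := by exact_mod_cast h4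
  have h5 : (1 : ℝ) ≤ (n : ℝ) ^ c := one_le_pow₀ (by linarith)
  have h6 : invPow 0 n = 1 := by simp [invPow]
  rw [h6] at h2
  have h7 := le_abs_self (p n)
  have h8 : (n : ℝ) ^ (c + 2) = (n : ℝ) ^ c * (n * n) := by ring
  have h9 : (9 : ℝ) ≤ n * n := by nlinarith
  rw [h8] at h2
  nlinarith

/-- Achievability: upper bounds on the testing rates are upper bounds on the measured rates. -/
theorem LiminfLE.measuredRate_of_testingRate (hρ : ∀ n, IsState (ρ n)) (hσ : ∀ n, IsState (σ n))
    {c : ℕ} (hc : ∀ l k, ∀ᶠ n in atTop,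
      measuredRate maxRelEntropy ρ σ l k n ≤ (((n : ℝ) ^ c : ℝ) : EReal))
    {ε : ℕ → ℝ} (hε : IsErrorFunction ε) {l l' : ℕ} (hl : l + 10 ≤ l') {b : ℕ → ℝ}
    (hb : LiminfLE (testingRate ρ σ ε l') b) : LiminfLE (measuredRate relEntropy ρ σ l) b := by
  intro a ha
  -- A single `k` is enough: the measurement on `n^k` copies is repeated on `n^j` blocks to cover
  -- all large exponents `k + j`.
  obtain ⟨k, hk⟩ := ha.exists
  obtain ⟨e, he⟩ := hε.2.exists_pow
  rw [neglLE_ext_iff]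
  intro K
  -- The three losses are the negligible error in `a`, the strictness needed to pick a near-optimal
  -- measurement, and the slack in Chebyshev's inequality.
  have hT : ∀ᶠ k' in atTop, NeglLE (ext fun n => a n - 3 * invPow (K + 1) n)
      (testingRate ρ σ ε l' k') := by
    -- Here `L = n^(k+c)` and `δ = n^k n^{-(K+1)}`, so the Chebyshev bound is at most `n^(2c + 1 +
    -- 2(K+1) - j)`, which has to be below `n^{-e} ≤ ε`.
    filter_upwards [eventually_ge_atTop (k + (2 * c + e + 2 * (K + 1) + 1))] with k' hk'
    obtain ⟨j, rfl⟩ := Nat.exists_eq_add_of_le (show k ≤ k' by omega)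
    apply neglLE_of_eventually
    filter_upwards [eventually_ge_atTop 12, hk.eventually_le (K + 1), he, hc l k]
      with n hn h1 h2 h3
    have hn12 : (12 : ℝ) ≤ n := by exact_mod_cast hn
    have hn0 : (0 : ℝ) < n := by linarith
    have hi := invPow_pos (K := K + 1) (n := n) (by omega)
    have h4 : (((n : ℝ) ^ k * (a n - 2 * invPow (K + 1) n) : ℝ) : EReal) <
        measuredDivergence (K := 2) relEntropy (tensorPow (ρ n) (n ^ k))
          (tensorPow (σ n) (n ^ k)) (n ^ (k * l)) := by
      rw [measuredRate, coe_le_inv_mul_iff (by positivity)] at h1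
      refine lt_of_lt_of_le ?_ h1
      rw [EReal.coe_lt_coe_iff]
      gcongr
      linarith
    rw [measuredDivergence, lt_iSup_iff] at h4
    obtain ⟨M, h4⟩ := h4
    rw [lt_iSup_iff] at h4
    obtain ⟨hM, h4⟩ := h4
    rw [measuredRate, inv_mul_le_coe_iff (by positivity)] at h3
    have hL := (le_measuredDivergence maxRelEntropy _ _ hM).trans h3
    have hεn : (((n : ℝ) ^ k * (n : ℝ) ^ c) ^ 2 + 4) /
        (((n ^ j : ℕ) : ℝ) * ((n : ℝ) ^ k * invPow (K + 1) n) ^ 2) ≤ ε n := by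
      have hεpos := (hε.1 n).1
      rw [abs_of_pos (inv_pos.2 hεpos)] at h2
      have hε' : ((n : ℝ) ^ e)⁻¹ ≤ ε n := inv_le_of_inv_le₀ hεpos h2
      refine le_trans ?_ hε'
      have hR : ((n ^ j : ℕ) : ℝ) * ((n : ℝ) ^ k * invPow (K + 1) n) ^ 2 =
          (n : ℝ) ^ j * ((n : ℝ) ^ k) ^ 2 / ((n : ℝ) ^ (K + 1)) ^ 2 := by
        rw [invPow, mul_pow, inv_pow, Nat.cast_pow]
        ring
      rw [div_le_iff₀ (by positivity), inv_mul_eq_div, le_div_iff₀ (by positivity), hR,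
        le_div_iff₀ (by positivity)]
      have h5 : (1 : ℝ) ≤ ((n : ℝ) ^ k * (n : ℝ) ^ c) ^ 2 := by
        apply one_le_pow₀
        exact one_le_mul_of_one_le_of_one_le (one_le_pow₀ (by linarith))
          (one_le_pow₀ (by linarith))
      calc (((n : ℝ) ^ k * (n : ℝ) ^ c) ^ 2 + 4) * (n : ℝ) ^ e * ((n : ℝ) ^ (K + 1)) ^ 2
          ≤ (n * ((n : ℝ) ^ k * (n : ℝ) ^ c) ^ 2) * (n : ℝ) ^ e * ((n : ℝ) ^ (K + 1)) ^ 2 := by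
            gcongr
            nlinarith
        _ = (n : ℝ) ^ (2 * c + e + 2 * (K + 1) + 1) * ((n : ℝ) ^ k) ^ 2 := by ring
        _ ≤ (n : ℝ) ^ j * ((n : ℝ) ^ k) ^ 2 := by
            gcongr
            · linarith
            · omega
    have key := le_hypothesisTestingRelEntropy (hρ n) (hσ n) hM
      (show n ^ (k + j) = n ^ j * n ^ k by rw [pow_add, mul_comm])
      (Nat.pos_of_ne_zero (by positivity)) (by positivity) hεn
      (block_complexity_le hn (by omega) hl) h4.le hL
    rw [testingRate, coe_le_inv_mul_iff (by positivity)]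
    convert key using 2
    push_cast
    ring
  filter_upwards [neglLE_ext_iff.1 (hb _ hT) (K + 1), eventually_mul_invPow_succ_le 4 K]
    with n h1 h2
  linarith

/-- Converse: the testing rates are bounded by the measured rates. -/
theorem eventually_mul_le_of_liminfLE_measuredRate (hρ : ∀ n, IsState (ρ n))
    (hσ : ∀ n, IsState (σ n)) {c : ℕ} (hN : ∀ᶠ n in atTop, N n ≤ n ^ c) {ε : ℕ → ℝ}
    (hε : ∀ n, 0 < ε n ∧ ε n < 1) {l l' : ℕ} (hl : 2 * l + (2 * c + 3) ≤ l') {a b : ℕ → ℝ}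
    (hb : LiminfLE (measuredRate relEntropy ρ σ l') b)
    (ha : ∀ᶠ k in atTop, NeglLE (ext a) (testingRate ρ σ ε l k)) (K : ℕ) :
    ∀ᶠ n in atTop, (1 - ε n) * (a n - invPow K n) ≤ b n + invPow K n := by
  have hS : ∀ᶠ k in atTop, NeglLE
      (ext fun n => (1 - ε n) * (a n - 2 * invPow (K + 1) n) - invPow (K + 1) n)
      (measuredRate relEntropy ρ σ l' k) := by
    -- For `k ≥ K + 1`, the term `log 2 / n^k` is covered by one inverse power `n^{-(K+1)}`.
    filter_upwards [ha, eventually_ge_atTop (K + 1)] with k hk hkK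
    apply neglLE_of_eventually
    filter_upwards [eventually_ge_atTop 92, hk.eventually_le (K + 1), hN] with n hn h1 h2
    have hn0 : (0 : ℝ) < n := by exact_mod_cast (by omega : 0 < n)
    have hi := invPow_pos (K := K + 1) (n := n) (by omega)
    have h4 : (((n : ℝ) ^ k * (a n - 2 * invPow (K + 1) n) : ℝ) : EReal) <
        hypothesisTestingRelEntropy (ε n) (tensorPow (ρ n) (n ^ k))
          (tensorPow (σ n) (n ^ k)) (n ^ (k * l)) := by
      rw [testingRate, coe_le_inv_mul_iff (by positivity)] at h1
      refine lt_of_lt_of_le ?_ h1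
      rw [EReal.coe_lt_coe_iff]
      gcongr
      linarith
    have key := le_measuredDivergence_relEntropy (isState_tensorPow (hρ n) _)
      (isState_tensorPow (hσ n) _) (hε n).2 (G' := n ^ (k * l')) (by
        rw [Fintype.card_prod, Fintype.card_fin, Fintype.card_fin]
        exact conjunction_complexity_le hn (by omega) h2 hl) h4
    rw [measuredRate, coe_le_inv_mul_iff (by positivity)]
    refine le_trans ?_ key
    rw [EReal.coe_le_coe_iff]
    have h5 : 1 ≤ (n : ℝ) ^ k * invPow (K + 1) n := by
      have h6 : (n : ℝ) ^ k * invPow k n = 1 := mul_inv_cancel₀ (by positivity)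
      rw [← h6]
      exact mul_le_mul_of_nonneg_left (invPow_anti (by omega) hkK) (by positivity)
    have h7 := Real.log_two_lt_d9
    nlinarith
  filter_upwards [neglLE_ext_iff.1 (hb _ hS) (K + 1), eventually_mul_invPow_succ_le 2 K]
    with n h1 h2
  have h3 : (1 - ε n) * (a n - invPow K n) ≤ (1 - ε n) * (a n - 2 * invPow (K + 1) n) := by
    apply mul_le_mul_of_nonneg_left _ (by linarith [(hε n).2])
    linarith
  linarith

theorem LiminfLE.testingRate_const (hρ : ∀ n, IsState (ρ n))
    (hσ : ∀ n, IsState (σ n)) {c : ℕ} (hN : ∀ᶠ n in atTop, N n ≤ n ^ c) {ε : ℝ}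
    (h0 : 0 < ε) (h1 : ε < 1) {l l' : ℕ} (hl : 2 * l + (2 * c + 3) ≤ l') {b : ℕ → ℝ}
    (hb : LiminfLE (measuredRate relEntropy ρ σ l') b) :
    LiminfLE (testingRate ρ σ (fun _ => ε) l) fun n => b n / (1 - ε) := by
  intro a ha
  rw [neglLE_ext_iff]
  intro K
  have hε : 0 < 1 - ε := by linarith
  filter_upwards [eventually_mul_le_of_liminfLE_measuredRate hρ hσ hN (fun _ => ⟨h0, h1⟩) hl hb ha
    (K + 1), eventually_mul_invPow_succ_le (1 + (1 - ε)⁻¹) K] with n h2 h3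
  rw [← le_div_iff₀' hε, add_div, div_eq_mul_inv (invPow _ _)] at h2
  linarith

theorem liminfLE_measuredRate_pow (hρ : ∀ n, IsState (ρ n)) (hσ : ∀ n, IsState (σ n))
    {c : ℕ} (hc : ∀ l k, ∀ᶠ n in atTop,
      measuredRate maxRelEntropy ρ σ l k n ≤ (((n : ℝ) ^ c : ℝ) : EReal)) (l : ℕ) :
    LiminfLE (measuredRate relEntropy ρ σ l) fun n => (n : ℝ) ^ c := by
  intro a ha
  obtain ⟨k, hk⟩ := ha.exists
  rw [neglLE_ext_iff]
  intro K
  filter_upwards [hk.eventually_le K, hc l k, eventually_gt_atTop 0] with n h1 h2 hn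
  have hn0 : (0 : ℝ) < n := by exact_mod_cast hn
  have h3 : measuredRate relEntropy ρ σ l k n ≤ (((n : ℝ) ^ c : ℝ) : EReal) := by
    rw [measuredRate, inv_mul_le_coe_iff (by positivity)] at h2 ⊢
    refine iSup₂_le fun M hM => ?_
    refine relEntropy_le_of_maxRelEntropy_le
      (prob_nonneg_of_mem_measurements hM (isState_tensorPow (hρ n) _)) ?_
      (prob_nonneg_of_mem_measurements hM (isState_tensorPow (hσ n) _))
      ((le_measuredDivergence maxRelEntropy _ _ hM).trans h2)
    rw [Fin.sum_univ_two]
    exact prob_add_of_mem_measurements hM (isState_tensorPow (hρ n) _)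
  have h4 := h1.trans h3
  rw [EReal.coe_le_coe_iff] at h4
  linarith

/-- Since `b` may grow arbitrarily, it is first replaced by its minimum with `n^d`. The converse
then gives `a = O(n^d)`, so removing the factor `1 - ε` costs `O(ε n^d)`, hence `O(n^{-(K+1)})`. -/
theorem LiminfLE.testingRate_of_small (hρ : ∀ n, IsState (ρ n)) (hσ : ∀ n, IsState (σ n))
    {c : ℕ} (hN : ∀ᶠ n in atTop, N n ≤ n ^ c) {d : ℕ} (hd : ∀ l k, ∀ᶠ n in atTop,
      measuredRate maxRelEntropy ρ σ l k n ≤ (((n : ℝ) ^ d : ℝ) : EReal))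
    {ε : ℕ → ℝ} (hε : ∀ n, 0 < ε n ∧ ε n < 1) {K : ℕ}
    (hεK : ∀ᶠ n in atTop, ε n ≤ invPow (d + (K + 1)) n)
    {l l' : ℕ} (hl : 2 * l + (2 * c + 3) ≤ l') {b : ℕ → ℝ}
    (hb : LiminfLE (measuredRate relEntropy ρ σ l') b) :
    LiminfLE (testingRate ρ σ ε l) fun n => b n + invPow K n := by
  intro a ha
  apply neglLE_of_eventually
  filter_upwards [eventually_mul_le_of_liminfLE_measuredRate hρ hσ hN hε hl
    (hb.min (liminfLE_measuredRate_pow hρ hσ hd l')) ha (K + 1), hεK,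
    eventually_mul_invPow_succ_le 6 K, eventually_ge_atTop 2] with n h1 h2 h3 hn
  have hn0 : (2 : ℝ) ≤ n := by exact_mod_cast hn
  have hb1 := min_le_left (b n) ((n : ℝ) ^ d)
  have hb2 := min_le_right (b n) ((n : ℝ) ^ d)
  have hε0 := (hε n).1
  have hnd : (1 : ℝ) ≤ (n : ℝ) ^ d := one_le_pow₀ (by linarith)
  set i := invPow (K + 1) n with hi
  have hi0 : 0 ≤ i := invPow_nonneg _ _
  have hi1 : 2 * i ≤ 1 := by
    have h4 := mul_invPow_succ_le (K := K) (n := n) (by omega) hn0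
    have h5 : invPow K n ≤ invPow 0 n := invPow_anti (by omega) (Nat.zero_le K)
    have h6 : invPow 0 n = 1 := by simp [invPow]
    linarith
  have hεi : ε n * (n : ℝ) ^ d ≤ i := by
    have h4 : invPow (d + (K + 1)) n * (n : ℝ) ^ d = i := by
      rw [hi, invPow, invPow, pow_add]
      field_simp
    rw [← h4]
    gcongr
  have hε2 : 2 * ε n ≤ 1 := by nlinarith
  set y := a n - i with hy
  have hεy : ε n * y ≤ 4 * i := by
    rcases le_or_gt y 0 with h | h
    · nlinarith
    · have h5 : y ≤ 4 * (n : ℝ) ^ d := by nlinarith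
      calc ε n * y ≤ ε n * (4 * (n : ℝ) ^ d) := by gcongr
        _ ≤ 4 * i := by linarith
  have hfin : a n ≤ b n + invPow K n := by nlinarith
  simpa only [ext, EReal.coe_le_coe_iff] using hfin

end Rates

end CompStein

namespace CompStein

/-! ### Comparison of the iterated limits -/

section Limits

variable {S : ℕ → ℕ → ℕ → EReal} {T : (ℕ → ℝ) → ℕ → ℕ → ℕ → EReal} {C d : ℕ}

theorem tendsto_sub_div_two (C : ℕ) : Tendsto (fun l : ℕ => (l - C) / 2) atTop atTop := by
  refine tendsto_atTop.2 fun m => ?_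
  filter_upwards [eventually_ge_atTop (2 * m + C)] with l hl
  omega

theorem tendsto_sub_ten : Tendsto (fun l : ℕ => l - 10) atTop atTop := by
  refine tendsto_atTop.2 fun m => ?_
  filter_upwards [eventually_ge_atTop (m + 10)] with l hl
  omega

/-- Lying below all upper bounds is antitone in the set of upper bounds; the two shifts add up to
less than `n^{-K}`. -/
theorem LELiminf.of_liminfLE_add {K : ℕ} {u v : ℕ → ℕ → EReal} {f : ℕ → ℝ}
    (h : ∀ b, LiminfLE v b → LiminfLE u fun n => b n + invPow (K + 1) n)
    (hf : LELiminf (fun n => f n - invPow (K + 1) n) u) :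
    LELiminf (fun n => f n - invPow K n) v := by
  intro b hb
  have h1 := neglLE_ext_iff.1 (hf _ (h b hb))
  rw [neglLE_ext_iff]
  intro K'
  filter_upwards [h1 K', eventually_mul_invPow_succ_le 2 K] with n h1 h2
  linarith

/-- Both bounds compare upper bounds of testing rates with upper bounds of measured rates, so the
limits agree. -/
theorem isLimLimLiminf_iff_isLimLiminf
    (hB : ∀ ε, IsErrorFunction ε → ∀ l l' b, l + 10 ≤ l' → LiminfLE (T ε l') b → LiminfLE (S l) b)
    (hA : ∀ K ε, IsErrorFunction ε → (∀ᶠ n in atTop, ε n ≤ invPow (d + (K + 1)) n) →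
      ∀ l l' b, 2 * l + C ≤ l' → LiminfLE (S l') b →
        LiminfLE (T ε l) fun n => b n + invPow K n) (f : ℕ → ℝ) :
    IsLimLimLiminf T f ↔ IsLimLiminf S f := by
  constructor
  · intro h
    have hε : ∀ K : ℕ, ∃ ε, IsErrorFunction ε ∧
        (∀ᶠ n in atTop, ε n ≤ invPow (d + (K + 1)) n) ∧
        ∀ᶠ l in atTop, LELiminf (fun n => f n - invPow K n) (T ε l) ∧
          LiminfLE (T ε l) fun n => f n + invPow K n := by
      intro K
      obtain ⟨η, hη, hlim⟩ := h _ (ofReal_exp_neg_pos K)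
      obtain ⟨K₀, hK₀⟩ := exists_ofReal_exp_neg_lt hη
      -- One error function suffices in this direction; `K'` makes it small both for the assumed
      -- limit and for the converse bound.
      set K' := K₀ + (d + (K + 1)) with hK'
      have hle := eventually_inv_pow_le_invPow K'
      refine ⟨_, isErrorFunction_inv_pow K' (by omega), ?_, ?_⟩
      · filter_upwards [hle, eventually_gt_atTop 0] with n h1 h2
        exact h1.trans (invPow_anti h2 (by omega))
      · have hd : asympDist (fun n => (((n : ℝ) + 2) ^ K')⁻¹) 0 < η := by
          refine lt_of_le_of_lt (asympDist_le_of_invPow (K := K') ?_) (hK₀ K' (by omega))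
          filter_upwards [hle] with n hn
          rwa [Pi.zero_apply, sub_zero, abs_of_nonneg (by positivity)]
        filter_upwards [hlim _ (isErrorFunction_inv_pow K' (by omega)) hd] with l hl
        exact ⟨hl.1.leLiminf, hl.2.liminfLE⟩
    constructor
    · intro δ hδ
      obtain ⟨K, hK⟩ := exists_ofReal_exp_neg_lt hδ
      obtain ⟨ε, hεe, hεs, hεl⟩ := hε (K + 1)
      -- The testing rate is taken at `l = (l' - C) / 2`, which tends to infinity with `l'` and
      -- satisfies `2 l + C ≤ l'`.
      filter_upwards [(tendsto_sub_div_two C).eventually hεl, eventually_ge_atTop C] with l' hl' hC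
      exact (LELiminf.of_liminfLE_add (fun b hb =>
        hA (K + 1) ε hεe hεs _ l' b (by omega) hb)
        hl'.1).within (hK K le_rfl)
    · intro δ hδ
      obtain ⟨K, hK⟩ := exists_ofReal_exp_neg_lt hδ
      obtain ⟨ε, hεe, -, hεl⟩ := hε K
      filter_upwards [(tendsto_add_atTop_nat 10).eventually hεl] with l hl
      exact (hB ε hεe l _ _ le_rfl hl.2).within (hK K le_rfl)
  · rintro ⟨h1, h2⟩ δ hδ
    obtain ⟨K, hK⟩ := exists_ofReal_exp_neg_lt hδ
    -- This radius forces `ε ≤ n^{-(d+K+2)}` eventually, the smallness that the converse needs at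
    -- precision `K + 1`.
    refine ⟨_, ofReal_exp_neg_pos (d + (K + 1 + 1)), fun ε hεe hεd => ?_⟩
    have hεs : ∀ᶠ n in atTop, ε n ≤ invPow (d + (K + 1 + 1)) n := by
      filter_upwards [eventually_abs_sub_le_invPow hεd] with n hn
      rw [Pi.zero_apply, sub_zero] at hn
      exact (le_abs_self _).trans hn
    filter_upwards [tendsto_sub_ten.eventually (h1 _ (ofReal_exp_neg_pos K)),
      (tendsto_atTop_mono (fun l => (by omega : l ≤ 2 * l + C)) tendsto_id).eventually
        (h2 _ (ofReal_exp_neg_pos (K + 1))), eventually_ge_atTop 10] with l hl1 hl2 h10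
    constructor
    · have h3 : LELiminf (fun n => f n - invPow K n) (T ε l) := fun b hb =>
        hl1.leLiminf b (hB ε hεe (l - 10) l b (by omega) hb)
      exact h3.within (hK K le_rfl)
    · have h3 := hA (K + 1) ε hεe hεs l _ _ le_rfl hl2.liminfLE
      have h4 : LiminfLE (T ε l) fun n => f n + invPow K n := by
        refine h3.mono ?_
        filter_upwards [eventually_mul_invPow_succ_le 2 K] with n hn
        linarith
      exact h4.within (hK K le_rfl)

theorem IsLimLiminf.neglEq {f g : ℕ → ℝ} (hf : IsLimLiminf S f) (hg : IsLimLiminf S g) :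
    NeglEq f g := by
  have key : ∀ {f g : ℕ → ℝ}, LELimLiminf f S → LimLiminfLE S g → ∀ K : ℕ,
      ∀ᶠ n in atTop, f n ≤ g n + invPow K n := by
    intro f g hf hg K
    obtain ⟨l, h1, h2⟩ := ((hf _ (ofReal_exp_neg_pos (K + 1))).and
      (hg _ (ofReal_exp_neg_pos (K + 1)))).exists
    filter_upwards [neglLE_ext_iff.1 (h1.leLiminf _ h2.liminfLE) (K + 1),
      eventually_mul_invPow_succ_le 3 K] with n h3 h4
    linarith
  refine asympDist_eq_zero_iff.2 fun K => ?_
  filter_upwards [key hf.1 hg.2 K, key hg.1 hf.2 K] with n h1 h2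
  rw [abs_le]
  constructor <;> linarith

theorem LELimLiminf.of_liminfLE {u : ℕ → ℕ → ℕ → EReal} {g : ℕ → ℝ} (hg : LELimLiminf g S)
    (hB : ∀ l l' b, l + 10 ≤ l' → LiminfLE (u l') b → LiminfLE (S l) b) : LELimLiminf g u := by
  intro δ hδ
  filter_upwards [tendsto_sub_ten.eventually (hg δ hδ), eventually_ge_atTop 10] with l hl h10
  obtain ⟨g', hg', h⟩ := hl
  exact ⟨g', hg', fun b hb => h b (hB (l - 10) l b (by omega) hb)⟩

theorem LimLiminfLE.div_of_liminfLE {u : ℕ → ℕ → ℕ → EReal} {g : ℕ → ℝ} {r : ℝ}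
    (hg : LimLiminfLE S g)
    (hA : ∀ l l' b, 2 * l + C ≤ l' → LiminfLE (S l') b → LiminfLE (u l) fun n => b n / r) :
    LimLiminfLE u fun n => g n / r := by
  intro δ hδ
  obtain ⟨K, hK⟩ := exists_ofReal_exp_neg_lt hδ
  filter_upwards [(tendsto_atTop_mono (fun l => (by omega : l ≤ 2 * l + C)) tendsto_id).eventually
    (hg _ (ofReal_exp_neg_pos (K + 1)))] with l hl
  have h1 := hA l _ _ le_rfl hl.liminfLE
  have h2 : LiminfLE (u l) fun n => g n / r + invPow K n := by
    refine h1.mono ?_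
    filter_upwards [eventually_mul_invPow_succ_le r⁻¹ K] with n hn
    rw [add_div, div_eq_mul_inv (invPow _ _), mul_comm (invPow _ _)]
    linarith
  exact h2.within (hK K le_rfl)

end Limits

end CompStein

theorem mainTheorem1 (N : ℕ → ℕ) (hN : CompStein.PolyBounded (fun n => (N n : ℝ)))
    (ρ σ : ∀ n, CompStein.Op (Fin (N n)))
    (hρ : ∀ n, CompStein.IsState (ρ n)) (hσ : ∀ n, CompStein.IsState (σ n))
    (hmax : CompStein.CompMeasuredMaxRelEntropyPolyBounded ρ σ) :
    (∀ f : ℕ → ℝ,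
      CompStein.IsCompRelEntropy ρ σ f ↔ CompStein.IsCompMeasuredRelEntropy ρ σ f) ∧
    (∀ f g : ℕ → ℝ, CompStein.IsCompRelEntropy ρ σ f →
      CompStein.IsCompMeasuredRelEntropy ρ σ g → CompStein.NeglEq f g) ∧
    (∀ g : ℕ → ℝ, CompStein.IsCompMeasuredRelEntropy ρ σ g → ∀ ε : ℝ, 0 < ε → ε < 1 →
      CompStein.LELimLiminf g (CompStein.testingRate ρ σ (fun _ => ε)) ∧
      CompStein.LimLiminfLE (CompStein.testingRate ρ σ (fun _ => ε))
        (fun n => g n / (1 - ε))) := by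
  obtain ⟨d, hd⟩ := CompStein.exists_pow_bound_measuredRate_max hρ hσ hmax
  obtain ⟨c, hc⟩ := hN.exists_pow
  have hNc : ∀ᶠ n in Filter.atTop, N n ≤ n ^ c := by
    filter_upwards [hc] with n hn
    rw [abs_of_nonneg (Nat.cast_nonneg _)] at hn
    exact_mod_cast hn
  have hB : ∀ ε, CompStein.IsErrorFunction ε → ∀ l l' b, l + 10 ≤ l' →
      CompStein.LiminfLE (CompStein.testingRate ρ σ ε l') b →
      CompStein.LiminfLE (CompStein.measuredRate CompStein.relEntropy ρ σ l) b :=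
    fun ε hε l l' b hl hb => hb.measuredRate_of_testingRate hρ hσ hd hε hl
  have hiff := CompStein.isLimLimLiminf_iff_isLimLiminf (d := d) (C := 2 * c + 3) hB
    fun K ε hε hεK l l' b hl hb => hb.testingRate_of_small hρ hσ hNc hd hε.1 hεK hl
  refine ⟨hiff, fun f g hf hg => ((hiff f).1 hf).neglEq hg, fun g hg ε h0 h1 => ⟨?_, ?_⟩⟩
  -- Achievability only asks that the error be at least inverse polynomial, so it covers constants
  -- without loss.
  · exact hg.1.of_liminfLE (hB _ (CompStein.isErrorFunction_const h0 h1))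
  · exact hg.2.div_of_liminfLE fun l l' b hl hb =>
      hb.testingRate_const hρ hσ hNc h0 h1 hl
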